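/- Let $(X,d)$ be a metric space. A temporal-sampling $P=\{P_i\}_{i=1}^t$ of length $t\ge 1$ is a sequence of finite non-empty subsets of $X$; its size is $n=\sum_{i=1}^t|P_i|$. A $k$-labeling of a set $Q$ is a map $L:Q\to 2^{[k]}$ whose values $L(p)$, $p\in Q$, are non-empty, pairwise disjoint and cover $[k]$. Two $k$-labelings $L_1,L_2$ of $Q_1,Q_2\subseteq X$ are $\delta$-contiguous if $L_1(u)\subseteq\bigcup_{v\in Q_2,\,d(u,v)\le\delta}L_2(v)$ for all $u\in Q_1$ and $L_2(v)\subseteq\bigcup_{u\in Q_1,\,d(u,v)\le\delta}L_1(u)$ for all $v\in Q_2$. For $\chi,\delta\ge 0$, a $(\chi,\delta)$-temporal hierarchical clustering of $P$ consists of pseudo-ultrametrics $\mu_i$ on $P_i$ $(1\le i\le t)$ with $\max_{u,v\in P_i}|d(u,v)-\mu_i(u,v)|\le\chi$, and of $k$-labelings $L_i$ of $P_i$ $(1\le i\le t)$, for one common $k\le n$, such that $L_i$ and $L_{i+1}$ are $\delta$-contiguous for all $1\le i<t$. **Theorem.** There is an $O(n^3)$-time algorithm with the following property. Given any temporal-sampling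 $P$ of size $n$ (its points listed in any order, with their levels and the matrix of their pairwise distances), it outputs functions $\mu_i:P_i\times P_i\to\mathbb{R}$, an integer $k$ and maps $L_i:P_i\to 2^{[k]}$ that form a $(\chi,\delta)$-temporal hierarchical clustering of $P$ for all $\chi,\delta\ge 0$ such that $P$ admits a $(\chi,\delta)$-temporal hierarchical clustering. Moreover, the output labelings come from a path cover: there are relations $\mathcal{C}_i\subseteq P_i\times P_{i+1}$ $(1\le i<t)$ that project onto $P_i$ and onto $P_{i+1}$, satisfy $d(u,v)\le\delta$ for all $(u,v)\in\mathcal{C}_i$ whenever $P$ admits a $(\chi,\delta)$-temporal hierarchical clustering for some $\chi \ge 0$ (with $\delta \ge 0$), and there are sequences $\tau_1,\dots,\tau_k$ with $\tau_j(i)\in P_i$ and $(\tau_j(i),\tau_j(i+1))\in\mathcal{C}_i$, such that every point of every level $P_i$ is $\tau_j(i)$ for some $j$, and $L_i(u)=\{j:\tau_j(i)=u\}$. Here an algorithm is a fixed program on a real RAM (arrays of natural numbers and of real numbers with computed indices; addition, truncated subtraction and comparison of natural numbers; rational constants, addition, subtraction, multiplication and comparison of real numbers; tests and loops), in which each elementary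 operation takes one step. The constant in $O(n^3)$ depends on nothing but the program: not on $X$, $t$, $P$, $\chi$ or $\delta$. -/

import Mathlib

/-! ### Temporal-samplings, ultrametric fits and labelings -/

namespace TemporalClustering

/-- A temporal-sampling of length `t`: a sequence of `t` finite, non-empty subsets of `X`. -/
structure TemporalSampling (X : Type*) (t : ℕ) where
  level : Fin t → Finset X
  nonempty : ∀ i, (level i).Nonempty

/-- The size of a temporal-sampling is the total number of points in its levels. -/
def TemporalSampling.size {X : Type*} {t : ℕ} (P : TemporalSampling X t) : ℕ :=
  ∑ i, (P.level i).card

/-- `μ` is the distance function of a pseudometric space satisfying the ultrametric inequality. -/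
def IsPseudoUltrametric {α : Type*} (μ : α → α → ℝ) : Prop :=
  ∃ m : PseudoMetricSpace α, (∀ x y, @dist α m.toDist x y = μ x y) ∧ @IsUltrametricDist α m.toDist

/-- The `ℓ^∞` distance of two distance functions on the same (finite) set. -/
noncomputable def linfDist {α : Type*} (μ ν : α → α → ℝ) : ℝ :=
  ⨆ p : α × α, |μ p.1 p.2 - ν p.1 p.2|

/-- A `k`-labeling assigns a set of labels in `[k]` to each point, such that these sets are the
blocks of a partition of `[k]` (each label is used at exactly one point). -/
structure IsLabeling {α : Type*} {k : ℕ} (L : α → Set (Fin k)) : Prop where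
  nonempty : ∀ p, (L p).Nonempty
  disjoint : ∀ p q, p ≠ q → Disjoint (L p) (L q)
  cover : ⋃ p, L p = Set.univ

/-- Labelings of two finite subsets of `X` are `δ`-contiguous (balls are closed). -/
def Contiguous {X : Type*} [MetricSpace X] {k : ℕ} (δ : ℝ) {A B : Finset X}
    (L₁ : A → Set (Fin k)) (L₂ : B → Set (Fin k)) : Prop :=
  (∀ u : A, L₁ u ⊆ ⋃ v ∈ {v : B | (v : X) ∈ Metric.closedBall (u : X) δ}, L₂ v) ∧
  (∀ v : B, L₂ v ⊆ ⋃ u ∈ {u : A | (u : X) ∈ Metric.closedBall (v : X) δ}, L₁ u)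

/-- `(μ i)`, `(L i)` form a `(χ, δ)`-temporal hierarchical clustering of `P`. -/
structure IsClustering {X : Type*} [MetricSpace X] {t : ℕ} (P : TemporalSampling X t) (χ δ : ℝ)
    (μ : ∀ i, P.level i → P.level i → ℝ) (k : ℕ) (L : ∀ i, P.level i → Set (Fin k)) : Prop where
  ultrametric : ∀ i, IsPseudoUltrametric (μ i)
  fit : ∀ i, linfDist (fun u v : P.level i => dist (u : X) (v : X)) (μ i) ≤ χ
  card_labels : k ≤ P.size
  labeling : ∀ i, IsLabeling (L i)
  contiguous : ∀ (i : ℕ) (h : i + 1 < t),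
    Contiguous δ (L ⟨i, Nat.lt_of_succ_lt h⟩) (L ⟨i + 1, h⟩)

/-- `P` admits a `(χ, δ)`-temporal hierarchical clustering. -/
def Admits {X : Type*} [MetricSpace X] {t : ℕ} (P : TemporalSampling X t) (χ δ : ℝ) : Prop :=
  ∃ (μ : ∀ i, P.level i → P.level i → ℝ) (k : ℕ) (L : ∀ i, P.level i → Set (Fin k)),
    IsClustering P χ δ μ k L

/-- A correspondence between `A` and `B`: a relation that projects onto both sides. -/
def IsCorrespondence {α β : Type*} (C : Set (α × β)) : Prop :=
  Prod.fst '' C = Set.univ ∧ Prod.snd '' C = Set.univ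

/-- A correspondence between finite subsets of `X` is `δ`-local. -/
def IsLocal {X : Type*} [MetricSpace X] (δ : ℝ) {A B : Finset X} (C : Set (A × B)) : Prop :=
  ∀ c ∈ C, dist (c.1 : X) (c.2 : X) ≤ δ

/-- A sequence of relations between successive levels of `P`. -/
abbrev TemporalSampling.Rel {X : Type*} {t : ℕ} (P : TemporalSampling X t) : Type _ :=
  ∀ (i : ℕ) (h : i + 1 < t),
    Set (P.level ⟨i, Nat.lt_of_succ_lt h⟩ × P.level ⟨i + 1, h⟩)

/-- The labelings `L` come from a path cover of the layered graph whose edges are given by `C`: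
there are `k` paths `τ j`, running through all levels along edges and together visiting every
point, such that `L i u` is the set of those `j` for which `τ j` visits `u` at level `i`. -/
def FromPathCover {X : Type*} {t : ℕ} (P : TemporalSampling X t) (C : P.Rel) {k : ℕ}
    (L : ∀ i, P.level i → Set (Fin k)) : Prop :=
  ∃ τ : Fin k → ∀ i, P.level i,
    (∀ j (i : ℕ) (h : i + 1 < t), (τ j ⟨i, Nat.lt_of_succ_lt h⟩, τ j ⟨i + 1, h⟩) ∈ C i h) ∧
    (∀ i (u : P.level i), ∃ j, τ j i = u) ∧
    (∀ i (u : P.level i), L i u = {j | τ j i = u})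

/-! ### The real RAM

Programs manipulate finitely many two-dimensional arrays of natural numbers and finitely many
two-dimensional arrays of reals, with computed indices. The operations are addition, truncated
subtraction and comparison of naturals, and addition, subtraction, multiplication and comparison
of reals; there is no rounding of reals and no multiplication of naturals. Every elementary
operation (including each memory access and each constant) counts as one step. -/

/-- Memory contents: `nat a i j` is the cell `(i, j)` of the natural number array `a`, and
`real a i j` is the cell `(i, j)` of the real array `a`. -/
structure Memory where
  nat : ℕ → ℕ → ℕ → ℕ
  real : ℕ → ℕ → ℕ → ℝ

inductive NExp
  | const (c : ℕ)
  | read (a : ℕ) (i j : NExp)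
  | add (e f : NExp)
  | sub (e f : NExp)

def NExp.eval (s : Memory) : NExp → ℕ
  | const c => c
  | read a i j => s.nat a (i.eval s) (j.eval s)
  | add e f => e.eval s + f.eval s
  | sub e f => e.eval s - f.eval s

def NExp.cost : NExp → ℕ
  | const _ => 1
  | read _ i j => i.cost + j.cost + 1
  | add e f => e.cost + f.cost + 1
  | sub e f => e.cost + f.cost + 1

inductive RExp
  | const (q : ℚ)
  | read (a : ℕ) (i j : NExp)
  | add (e f : RExp)
  | sub (e f : RExp)
  | mul (e f : RExp)

noncomputable def RExp.eval (s : Memory) : RExp → ℝ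
  | const q => (q : ℝ)
  | read a i j => s.real a (i.eval s) (j.eval s)
  | add e f => e.eval s + f.eval s
  | sub e f => e.eval s - f.eval s
  | mul e f => e.eval s * f.eval s

def RExp.cost : RExp → ℕ
  | const _ => 1
  | read _ i j => i.cost + j.cost + 1
  | add e f => e.cost + f.cost + 1
  | sub e f => e.cost + f.cost + 1
  | mul e f => e.cost + f.cost + 1

inductive Test
  | natLe (e f : NExp)
  | realLe (e f : RExp)
  | neg (b : Test)
  | conj (b c : Test)

def Test.Holds (s : Memory) : Test → Prop
  | natLe e f => e.eval s ≤ f.eval s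
  | realLe e f => e.eval s ≤ f.eval s
  | neg b => ¬ b.Holds s
  | conj b c => b.Holds s ∧ c.Holds s

def Test.cost : Test → ℕ
  | natLe e f => e.cost + f.cost + 1
  | realLe e f => e.cost + f.cost + 1
  | neg b => b.cost + 1
  | conj b c => b.cost + c.cost + 1

/-- Assign the value `v` to the cell `(i, j)` of the natural number array `a`. -/
def Memory.setNat (s : Memory) (a i j v : ℕ) : Memory :=
  { s with nat := fun a' i' j' => if a' = a ∧ i' = i ∧ j' = j then v else s.nat a' i' j' }

/-- Assign the value `v` to the cell `(i, j)` of the real array `a`. -/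
noncomputable def Memory.setReal (s : Memory) (a i j : ℕ) (v : ℝ) : Memory :=
  { s with real := fun a' i' j' => if a' = a ∧ i' = i ∧ j' = j then v else s.real a' i' j' }

inductive Prog
  | skip
  | setNat (a : ℕ) (i j e : NExp)
  | setReal (a : ℕ) (i j : NExp) (e : RExp)
  | seq (p q : Prog)
  | ite (b : Test) (p q : Prog)
  | loop (b : Test) (p : Prog)

/-- `Exec p s T s'`: started with memory `s`, the program `p` halts after exactly `T` steps
with memory `s'`. (`Prog.loop b p` repeats `p` while `b` holds.) -/
inductive Exec : Prog → Memory → ℕ → Memory → Prop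
  | skip (s : Memory) : Exec .skip s 1 s
  | setNat (s : Memory) (a : ℕ) (i j e : NExp) :
      Exec (.setNat a i j e) s (i.cost + j.cost + e.cost + 1)
        (s.setNat a (i.eval s) (j.eval s) (e.eval s))
  | setReal (s : Memory) (a : ℕ) (i j : NExp) (e : RExp) :
      Exec (.setReal a i j e) s (i.cost + j.cost + e.cost + 1)
        (s.setReal a (i.eval s) (j.eval s) (e.eval s))
  | seq {p q : Prog} {s s₁ s₂ : Memory} {T₁ T₂ : ℕ} :
      Exec p s T₁ s₁ → Exec q s₁ T₂ s₂ → Exec (.seq p q) s (T₁ + T₂) s₂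
  | ite_true {b : Test} {p q : Prog} {s s' : Memory} {T : ℕ} :
      b.Holds s → Exec p s T s' → Exec (.ite b p q) s (b.cost + T + 1) s'
  | ite_false {b : Test} {p q : Prog} {s s' : Memory} {T : ℕ} :
      ¬ b.Holds s → Exec q s T s' → Exec (.ite b p q) s (b.cost + T + 1) s'
  | loop_stop {b : Test} {p : Prog} {s : Memory} :
      ¬ b.Holds s → Exec (.loop b p) s (b.cost + 1) s
  | loop_step {b : Test} {p : Prog} {s s₁ s₂ : Memory} {T₁ T₂ : ℕ} :
      b.Holds s → Exec p s T₁ s₁ → Exec (.loop b p) s₁ T₂ s₂ →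
      Exec (.loop b p) s (b.cost + 1 + T₁ + T₂) s₂

/-- Programs are deterministic: the running time and the final memory are unique. -/
theorem Exec.deterministic {p : Prog} {s s₁ s₂ : Memory} {T₁ T₂ : ℕ}
    (h₁ : Exec p s T₁ s₁) (h₂ : Exec p s T₂ s₂) : T₁ = T₂ ∧ s₁ = s₂ := by
  induction h₁ generalizing T₂ s₂ with
  | skip => cases h₂; exact ⟨rfl, rfl⟩
  | setNat => cases h₂; exact ⟨rfl, rfl⟩
  | setReal => cases h₂; exact ⟨rfl, rfl⟩
  | seq _ _ ih ih' =>
    cases h₂ with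
    | seq k k' =>
      obtain ⟨rfl, rfl⟩ := ih k
      obtain ⟨rfl, rfl⟩ := ih' k'
      exact ⟨rfl, rfl⟩
  | ite_true hb _ ih =>
    cases h₂ with
    | ite_true _ k => obtain ⟨rfl, rfl⟩ := ih k; exact ⟨rfl, rfl⟩
    | ite_false hb' _ => exact absurd hb hb'
  | ite_false hb _ ih =>
    cases h₂ with
    | ite_true hb' _ => exact absurd hb' hb
    | ite_false _ k => obtain ⟨rfl, rfl⟩ := ih k; exact ⟨rfl, rfl⟩
  | loop_stop hb =>
    cases h₂ with
    | loop_stop => exact ⟨rfl, rfl⟩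
    | loop_step hb' => exact absurd hb' hb
  | loop_step hb _ _ ih ih' =>
    cases h₂ with
    | loop_stop hb' => exact absurd hb hb'
    | loop_step _ k k' =>
      obtain ⟨rfl, rfl⟩ := ih k
      obtain ⟨rfl, rfl⟩ := ih' k'
      exact ⟨rfl, rfl⟩

/-! ### Input and output -/

/-- The input format. The pairs (level, point of that level) are listed in an arbitrary order
`e`. Array `0` of naturals holds the size in cell `(0, 0)` and the length in cell `(0, 1)`;
array `1` of naturals holds the level of the `p`-th pair in cell `(p, 0)`; array `0` of reals
holds the matrix of distances. All other cells are `0`. -/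
noncomputable def input {X : Type*} [MetricSpace X] {t : ℕ} (P : TemporalSampling X t)
    (e : Fin P.size ≃ Σ i : Fin t, P.level i) : Memory where
  nat a i j :=
    if a = 0 ∧ i = 0 ∧ j = 0 then P.size
    else if a = 0 ∧ i = 0 ∧ j = 1 then t
    else if h : i < P.size then
      if a = 1 ∧ j = 0 then ((e ⟨i, h⟩).1 : ℕ) else 0
    else 0
  real a i j :=
    if h : i < P.size ∧ j < P.size then
      if a = 0 then dist ((e ⟨i, h.1⟩).2 : X) ((e ⟨j, h.2⟩).2 : X) else 0
    else 0

/-- The output number of labels: cell `(0, 0)` of array `2` of naturals. -/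
def outK (s : Memory) : ℕ := s.nat 2 0 0

/-- The output distance functions: array `1` of reals, indexed by pairs of points. -/
def outDist {X : Type*} {t : ℕ} (P : TemporalSampling X t)
    (e : Fin P.size ≃ Σ i : Fin t, P.level i) (s : Memory) (i : Fin t) (u v : P.level i) : ℝ :=
  s.real 1 (e.symm ⟨i, u⟩) (e.symm ⟨i, v⟩)

/-- The output labelings: `j` is a label of a point iff the cell (point, `j`) of array `3` of
naturals is `1`. -/
def outLabel {X : Type*} {t : ℕ} (P : TemporalSampling X t)
    (e : Fin P.size ≃ Σ i : Fin t, P.level i) (s : Memory) (i : Fin t) (u : P.level i) :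
    Set (Fin (outK s)) :=
  {j | s.nat 3 (e.symm ⟨i, u⟩) j = 1}

end TemporalClustering

/-! The algorithm treats the two parameters separately, and optimizes both of them at once.

*Distances.* Let `u` be the subdominant ultrametric of `d` on a level: `u p q` is the least maximal
step of a path from `p` to `q` inside the level. It satisfies `u ≤ d`, and a pseudo-ultrametric `μ`
with `|d - μ| ≤ χ` satisfies `μ ≤ u + χ` (`le_subdominant_add`), whence `d - u ≤ 2 * χ`
(`Admits.error_le`). So if `ε` is the maximum of `d - u`, then `u + ε / 2` off the diagonal is a
pseudo-ultrametric (`isPseudoUltrametric_outDist`) at distance at most `ε / 2 ≤ χ` from `d`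
(`linfDist_outDist_le`). All the `u` are computed in place by the Floyd–Warshall recursion
(`subdominant`, `relaxLoop_spec`), which takes cubic time and dominates the running time.

*Labels.* In `k`-labelings that are `δ`-contiguous, every point has a point within `δ` in the next
and in the previous level. Hence nearest neighbours in these levels are within `δ`, and joining all
points to them gives a correspondence that is `δ`-local for every admissible `δ`
(`isCorrespondence_neighbourRel`, `isLocal_neighbourRel`). There is one path for each of the `n`
points, which follows nearest neighbours upwards and downwards from it
(`fromPathCover_neighbourRel`); thus `k = n` labels suffice, and no minimal path cover is needed.

*Running time.* Programs are verified with total correctness triples `Terminates` that carry a time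
bound. Loops are counting loops up to the size of the input, with the rule `forLoop_spec`; loop
bodies are loop-free and are executed symbolically by `Prog.run`. -/

namespace TemporalClustering

/-! ### A program logic for the real RAM -/

/-- The effect of a loop-free program on the memory (loops are ignored). -/
noncomputable def Prog.run : Prog → Memory → Memory
  | skip, s => s
  | setNat a i j e, s => s.setNat a (i.eval s) (j.eval s) (e.eval s)
  | setReal a i j e, s => s.setReal a (i.eval s) (j.eval s) (e.eval s)
  | seq p q, s => q.run (p.run s)
  | ite b p q, s => open Classical in if b.Holds s then p.run s else q.run s
  | loop _ _, s => s

/-- An upper bound for the running time of a loop-free program (loops are ignored). -/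
def Prog.bound : Prog → ℕ
  | skip => 1
  | setNat _ i j e => i.cost + j.cost + e.cost + 1
  | setReal _ i j e => i.cost + j.cost + e.cost + 1
  | seq p q => p.bound + q.bound
  | ite b p q => b.cost + max p.bound q.bound + 1
  | loop _ _ => 0

/-- `p` has no loops. -/
def Prog.LoopFree : Prog → Prop
  | seq p q | ite _ p q => p.LoopFree ∧ q.LoopFree
  | loop _ _ => False
  | _ => True

/-- The natural number arrays that occur as targets of assignments. -/
def Prog.natWrites : Prog → Finset ℕ
  | skip | setReal _ _ _ _ => ∅
  | setNat a _ _ _ => {a}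
  | seq p q | ite _ p q => p.natWrites ∪ q.natWrites
  | loop _ p => p.natWrites

/-- The real arrays that occur as targets of assignments. -/
def Prog.realWrites : Prog → Finset ℕ
  | skip | setNat _ _ _ _ => ∅
  | setReal a _ _ _ => {a}
  | seq p q | ite _ p q => p.realWrites ∪ q.realWrites
  | loop _ p => p.realWrites

/-- The arrays that `p` does not assign to agree in `s` and `s'`. -/
structure Unchanged (p : Prog) (s s' : Memory) : Prop where
  nat : ∀ a, a ∉ p.natWrites → s'.nat a = s.nat a
  real : ∀ a, a ∉ p.realWrites → s'.real a = s.real a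

theorem Unchanged.refl (p : Prog) (s : Memory) : Unchanged p s s :=
  ⟨fun _ _ => rfl, fun _ _ => rfl⟩

theorem Unchanged.trans {p : Prog} {s₁ s₂ s₃ : Memory} (h : Unchanged p s₁ s₂)
    (h' : Unchanged p s₂ s₃) : Unchanged p s₁ s₃ :=
  ⟨fun a ha => (h'.nat a ha).trans (h.nat a ha), fun a ha => (h'.real a ha).trans (h.real a ha)⟩

theorem Unchanged.mono {p q : Prog} {s s' : Memory} (h : Unchanged p s s')
    (hn : p.natWrites ⊆ q.natWrites) (hr : p.realWrites ⊆ q.realWrites) : Unchanged q s s' :=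
  ⟨fun a ha => h.nat a fun h => ha (hn h), fun a ha => h.real a fun h => ha (hr h)⟩

theorem Memory.setNat_nat (s : Memory) (a i j v a' i' j' : ℕ) :
    (s.setNat a i j v).nat a' i' j' = if a' = a ∧ i' = i ∧ j' = j then v else s.nat a' i' j' := rfl

theorem Memory.setReal_real (s : Memory) (a i j : ℕ) (v : ℝ) (a' i' j' : ℕ) :
    (s.setReal a i j v).real a' i' j' =
      if a' = a ∧ i' = i ∧ j' = j then v else s.real a' i' j' := rfl

/-- The frame property: a program changes only the arrays that it assigns to. -/
theorem Exec.unchanged {p : Prog} {s s' : Memory} {T : ℕ} (h : Exec p s T s') :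
    Unchanged p s s' := by
  induction h with
  | skip s => exact .refl _ s
  | setNat s a i j e =>
    refine ⟨fun b hb => ?_, fun _ _ => rfl⟩
    have hb : b ≠ a := by simpa [Prog.natWrites] using hb
    funext x y
    simp [Memory.setNat_nat, hb]
  | setReal s a i j e =>
    refine ⟨fun _ _ => rfl, fun b hb => ?_⟩
    have hb : b ≠ a := by simpa [Prog.realWrites] using hb
    funext x y
    simp [Memory.setReal_real, hb]
  | seq _ _ ih ih' =>
    exact (ih.mono Finset.subset_union_left Finset.subset_union_left).trans
      (ih'.mono Finset.subset_union_right Finset.subset_union_right)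
  | ite_true _ _ ih => exact ih.mono Finset.subset_union_left Finset.subset_union_left
  | ite_false _ _ ih => exact ih.mono Finset.subset_union_right Finset.subset_union_right
  | loop_stop => exact .refl _ _
  | loop_step _ _ _ ih ih' => exact Unchanged.trans ⟨ih.nat, ih.real⟩ ih'

/-- Total correctness with a time bound: started in `s`, the program `p` halts after at most `B`
steps in a memory satisfying `Q`. -/
def Terminates (p : Prog) (s : Memory) (B : ℕ) (Q : Memory → Prop) : Prop :=
  ∃ T s', Exec p s T s' ∧ T ≤ B ∧ Q s'

theorem Terminates.mono {p : Prog} {s : Memory} {B B' : ℕ} {Q Q' : Memory → Prop}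
    (h : Terminates p s B Q) (hB : B ≤ B') (hQ : ∀ s', Unchanged p s s' → Q s' → Q' s') :
    Terminates p s B' Q' :=
  let ⟨T, s', hp, hT, hs⟩ := h
  ⟨T, s', hp, hT.trans hB, hQ s' hp.unchanged hs⟩

theorem Terminates.seq {p q : Prog} {s : Memory} {B B' : ℕ} {Q R : Memory → Prop}
    (hp : Terminates p s B Q)
    (hq : ∀ s', Unchanged p s s' → Q s' → Terminates q s' B' R) :
    Terminates (.seq p q) s (B + B') R := by
  obtain ⟨T, s', h, hT, hs⟩ := hp
  obtain ⟨T', s'', h', hT', hs'⟩ := hq s' h.unchanged hs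
  exact ⟨T + T', s'', h.seq h', Nat.add_le_add hT hT', hs'⟩

theorem Prog.LoopFree.exec {p : Prog} (hp : p.LoopFree) (s : Memory) :
    ∃ T, Exec p s T (p.run s) ∧ T ≤ p.bound := by
  induction p generalizing s with
  | skip => exact ⟨_, .skip s, le_rfl⟩
  | setNat a i j e => exact ⟨_, .setNat s a i j e, le_rfl⟩
  | setReal a i j e => exact ⟨_, .setReal s a i j e, le_rfl⟩
  | seq p q ih ih' =>
    obtain ⟨T, h, hT⟩ := ih hp.1 s
    obtain ⟨T', h', hT'⟩ := ih' hp.2 (p.run s)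
    exact ⟨_, h.seq h', Nat.add_le_add hT hT'⟩
  | ite b p q ih ih' =>
    by_cases hb : b.Holds s
    · obtain ⟨T, h, hT⟩ := ih hp.1 s
      refine ⟨_, by simpa [Prog.run, hb] using Exec.ite_true hb h, ?_⟩
      have := le_max_left p.bound q.bound
      simp only [Prog.bound]
      omega
    · obtain ⟨T, h, hT⟩ := ih' hp.2 s
      refine ⟨_, by simpa [Prog.run, hb] using Exec.ite_false hb h, ?_⟩
      have := le_max_right p.bound q.bound
      simp only [Prog.bound]
      omega
  | loop b p => exact hp.elim

theorem Prog.LoopFree.terminates {p : Prog} (hp : p.LoopFree) {s : Memory} {Q : Memory → Prop}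
    (h : Q (p.run s)) : Terminates p s p.bound Q :=
  let ⟨T, h', hT⟩ := hp.exec s
  ⟨T, _, h', hT, h⟩

/-- The value of the loop counter kept in cell `(0, 0)` of array `c`. -/
def counter (c : ℕ) : NExp := .read c (.const 0) (.const 0)

@[simp] theorem counter_eval (c : ℕ) (s : Memory) : (counter c).eval s = s.nat c 0 0 := rfl

/-- Run `p` with the counter `c` ranging over all indices below the input size. -/
def forLoop (c : ℕ) (p : Prog) : Prog :=
  .seq (.setNat c (.const 0) (.const 0) (.const 0))
    (.loop (.neg (.natLe (counter 0) (counter c)))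
      (.seq p (.setNat c (.const 0) (.const 0) (.add (counter c) (.const 1)))))

/-- The invariant rule for `forLoop`. The invariant need not mention the arrays that the loop
leaves alone; the constant `30` covers initialization, tests and increments. -/
theorem forLoop_spec {c : ℕ} {p : Prog} {n B : ℕ} {s₀ : Memory} (I : ℕ → Memory → Prop)
    (hn : 1 ≤ n) (hsize : s₀.nat 0 0 0 = n) (hc : c ∉ p.natWrites) (hp : 0 ∉ p.natWrites)
    (hc0 : c ≠ 0) (hI : ∀ i s v, I i s → I i (s.setNat c 0 0 v)) (hstart : I 0 s₀)
    (hstep : ∀ i < n, ∀ s, Unchanged (forLoop c p) s₀ s → s.nat c 0 0 = i → I i s →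
      Terminates p s B (I (i + 1))) :
    Terminates (forLoop c p) s₀ (n * (B + 30)) (I n) := by
  -- `m` is the number of remaining iterations; an iteration takes at most `B + 17` steps.
  have key : ∀ m i s, i + m = n → Unchanged (forLoop c p) s₀ s → s.nat c 0 0 = i → I i s →
      Terminates (.loop (.neg (.natLe (counter 0) (counter c)))
        (.seq p (.setNat c (.const 0) (.const 0) (.add (counter c) (.const 1))))) s
        (m * (B + 17) + 9) (I n) := by
    have h0 : 0 ∉ (forLoop c p).natWrites := by
      simp [forLoop, Prog.natWrites, hp, hc0.symm]
    intro m
    induction m with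
    | zero =>
      intro i s him hs hi hIs
      refine ⟨_, s, Exec.loop_stop ?_, by simp [Test.cost, NExp.cost, counter],
        by simpa [← him] using hIs⟩
      simp only [Test.Holds, counter_eval, hs.nat 0 h0, hsize, hi]
      omega
    | succ m ih =>
      intro i s him hs hi hIs
      obtain ⟨T, s₁, hex, hT, hI₁⟩ := hstep i (by omega) s hs hi hIs
      have hu : Unchanged (forLoop c p) s s₁ := hex.unchanged.mono
        (by simp only [forLoop, Prog.natWrites]; intro x hx; simp [hx])
        (by simp only [forLoop, Prog.realWrites]; intro x hx; simp [hx])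
      have hinc : Exec (.setNat c (.const 0) (.const 0) (.add (counter c) (.const 1))) s₁ 8
          (s₁.setNat c 0 0 (i + 1)) := by
        have := Exec.setNat s₁ c (.const 0) (.const 0) (.add (counter c) (.const 1))
        simpa [NExp.eval, NExp.cost, counter, hex.unchanged.nat c hc, hi] using this
      have hu' : Unchanged (forLoop c p) s₁ (s₁.setNat c 0 0 (i + 1)) := hinc.unchanged.mono
        (by simp only [forLoop, Prog.natWrites]; intro x hx; simp_all) (by simp [Prog.realWrites])
      obtain ⟨T', s₂, hex', hT', hI₂⟩ := ih (i + 1) _ (by omega) ((hs.trans hu).trans hu')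
        (by simp [Memory.setNat_nat]) (hI _ _ (i + 1) hI₁)
      refine ⟨_, s₂, .loop_step ?_ (hex.seq hinc) hex', ?_, hI₂⟩
      · simp only [Test.Holds, counter_eval, hs.nat 0 h0, hsize, hi]
        omega
      · simp only [Test.cost, NExp.cost, counter]
        linarith
  have hinit : Exec (.setNat c (.const 0) (.const 0) (.const 0)) s₀ 4 (s₀.setNat c 0 0 0) := by
    simpa [NExp.eval, NExp.cost] using Exec.setNat s₀ c (.const 0) (.const 0) (.const 0)
  obtain ⟨T, s, hex, hT, hIs⟩ := key n 0 (s₀.setNat c 0 0 0) (by omega)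
    (hinit.unchanged.mono (by simp only [forLoop, Prog.natWrites]; intro x hx; simp_all)
      (by simp [Prog.realWrites])) (by simp [Memory.setNat_nat]) (hI _ _ _ hstart)
  refine ⟨_, s, hinit.seq hex, ?_, hIs⟩
  nlinarith

/-- Run `p` for all pairs of indices below the input size; the counters are in arrays `5`, `6`. -/
def forPairs (p : Prog) : Prog := forLoop 5 (forLoop 6 p)

theorem forPairs_spec {p : Prog} {n : ℕ} {s₀ : Memory} (I : ℕ → ℕ → Memory → Prop)
    (hlf : p.LoopFree) (hn : 1 ≤ n) (hsize : s₀.nat 0 0 0 = n)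
    (hw : 0 ∉ p.natWrites ∧ 5 ∉ p.natWrites ∧ 6 ∉ p.natWrites)
    (hI : ∀ i j s c v, c = 5 ∨ c = 6 → I i j s → I i j (s.setNat c 0 0 v))
    (hstart : I 0 0 s₀) (hrow : ∀ i s, I i n s → I (i + 1) 0 s)
    (hstep : ∀ i < n, ∀ j < n, ∀ s, Unchanged (forPairs p) s₀ s → s.nat 5 0 0 = i →
      s.nat 6 0 0 = j → I i j s → I i (j + 1) (p.run s)) :
    Terminates (forPairs p) s₀ (n * (n * (p.bound + 30) + 30)) (I n 0) := by
  obtain ⟨h0, h5, h6⟩ := hw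
  have h0' : 0 ∉ (forLoop 6 p).natWrites := by simp [forLoop, Prog.natWrites, h0]
  have h5' : 5 ∉ (forLoop 6 p).natWrites := by simp [forLoop, Prog.natWrites, h5]
  have h0'' : 0 ∉ (forPairs p).natWrites := by simp [forPairs, forLoop, Prog.natWrites, h0]
  refine forLoop_spec (fun i => I i 0) hn hsize h5' h0' (by decide)
    (fun i s v h => hI _ _ _ _ _ (.inl rfl) h) hstart fun i hi s hs hsi hIs => ?_
  refine (forLoop_spec (fun j => I i j) hn ((congrFun₂ (hs.nat 0 h0'') 0 0).trans hsize) h6 h0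
    (by decide) (fun j s v h => hI _ _ _ _ _ (.inr rfl) h) hIs fun j hj s' hs' hsj hIs' => ?_).mono
      le_rfl fun s' _ h => hrow i s' h
  refine hlf.terminates (hstep i hi j hj s' (hs.trans (hs'.mono ?_ ?_)) ?_ hsj hIs')
  · intro x hx
    simp only [forLoop, Prog.natWrites, Finset.mem_union, Finset.mem_singleton] at hx ⊢
    tauto
  · intro x hx
    simp only [forLoop, Prog.realWrites, Finset.mem_union] at hx ⊢
    tauto
  · rw [hs'.nat 5 h5', hsi]

/-- A pass of `forPairs` that overwrites every entry of real array `1`, each assignment being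
correct while the entries before it are new and the others are old. -/
theorem forPairs_update {p : Prog} {n : ℕ} {s₀ : Memory} (new : ℕ → ℕ → ℝ)
    (hlf : p.LoopFree) (hn : 1 ≤ n) (hsize : s₀.nat 0 0 0 = n) (hw : p.natWrites = ∅)
    (hstep : ∀ i < n, ∀ j < n, ∀ s, Unchanged (forPairs p) s₀ s → s.nat 5 0 0 = i →
      s.nat 6 0 0 = j →
      (∀ x < n, ∀ y < n, s.real 1 x y =
        if x < i ∨ x = i ∧ y < j then new x y else s₀.real 1 x y) →
      ∀ x y, (p.run s).real 1 x y = if x = i ∧ y = j then new i j else s.real 1 x y) :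
    Terminates (forPairs p) s₀ (n * (n * (p.bound + 30) + 30))
      (fun s => ∀ x < n, ∀ y < n, s.real 1 x y = new x y) := by
  refine (forPairs_spec (fun i j s => ∀ x < n, ∀ y < n, s.real 1 x y =
      if x < i ∨ x = i ∧ y < j then new x y else s₀.real 1 x y) hlf hn hsize (by simp [hw])
      (fun i j s c v _ h => h) (by simp) ?_ ?_).mono le_rfl ?_
  · intro i s h x hx y hy
    rw [h x hx y hy]
    exact if_congr (by omega) rfl rfl
  · intro i hi j hj s hs hsi hsj h x hx y hy
    rw [hstep i hi j hj s hs hsi hsj h]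
    split_ifs with h₁ h₂ h₂
    · rw [h₁.1, h₁.2]
    · omega
    · rw [h x hx y hy, if_pos (by omega)]
    · rw [h x hx y hy, if_neg (by omega)]
  · intro s _ h x hx y hy
    rw [h x hx y hy, if_pos (by omega)]

/-- The level of the point `e`, as an expression. -/
def lvl (e : NExp) : NExp := .read 1 e (.const 0)

@[simp] theorem lvl_eval (e : NExp) (s : Memory) : (lvl e).eval s = s.nat 1 (e.eval s) 0 := rfl

/-- The test whether two natural numbers are equal. -/
def Test.natEq (e f : NExp) : Test := .conj (.natLe e f) (.natLe f e)

@[simp] theorem Test.natEq_holds (e f : NExp) (s : Memory) :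
    (Test.natEq e f).Holds s ↔ e.eval s = f.eval s :=
  ⟨fun h => le_antisymm h.1 h.2, fun h => ⟨h.le, h.ge⟩⟩

/-! ### The subdominant ultrametric -/

/-- The `k`-th stage of the Floyd–Warshall recursion for minimax paths inside the levels:
`subdominant lev d k p q` is the least maximal step of a path from `p` to `q` whose interior points
are below `k` and in the level of `p` and `q`. -/
noncomputable def subdominant (lev : ℕ → ℕ) (d : ℕ → ℕ → ℝ) : ℕ → ℕ → ℕ → ℝ
  | 0, p, q => d p q
  | k + 1, p, q =>
    if lev p = lev k ∧ lev q = lev k then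
      min (subdominant lev d k p q) (max (subdominant lev d k p k) (subdominant lev d k k q))
    else subdominant lev d k p q

section subdominant

variable {lev : ℕ → ℕ} {d : ℕ → ℕ → ℝ}

theorem subdominant_le (k p q : ℕ) : subdominant lev d k p q ≤ d p q := by
  induction k with
  | zero => exact le_rfl
  | succ k ih =>
    rw [subdominant]
    split_ifs
    · exact (min_le_left _ _).trans ih
    · exact ih

theorem subdominant_comm {n : ℕ} (hd : ∀ p < n, ∀ q < n, d p q = d q p) {k : ℕ} (hk : k ≤ n)
    {p q : ℕ} (hp : p < n) (hq : q < n) : subdominant lev d k p q = subdominant lev d k q p := by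
  induction k generalizing p q with
  | zero => exact hd p hp q hq
  | succ k ih =>
    have hk' : k ≤ n := by omega
    rw [subdominant, subdominant, ih hk' hp hq, ih hk' hp hk, ih hk' hk hq, max_comm]
    exact if_congr and_comm rfl rfl

theorem subdominant_nonneg {n : ℕ} (hd : ∀ p < n, ∀ q < n, 0 ≤ d p q) {k : ℕ} (hk : k ≤ n)
    {p q : ℕ} (hp : p < n) (hq : q < n) : 0 ≤ subdominant lev d k p q := by
  induction k generalizing p q with
  | zero => exact hd p hp q hq
  | succ k ih =>
    have hk' : k ≤ n := by omega
    rw [subdominant]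
    split_ifs
    · exact le_min (ih hk' hp hq) (le_max_of_le_left (ih hk' hp hk))
    · exact ih hk' hp hq

/-- Row `k` does not change in stage `k`, so the recursion can be run in place. -/
theorem subdominant_succ_row (k q : ℕ) :
    subdominant lev d (k + 1) k q = subdominant lev d k k q := by
  rw [subdominant]
  split_ifs
  · simp
  · rfl

theorem subdominant_succ_col (k p : ℕ) :
    subdominant lev d (k + 1) p k = subdominant lev d k p k := by
  rw [subdominant]
  split_ifs
  · simp
  · rfl

theorem subdominant_succ_le (k p q : ℕ) :
    subdominant lev d (k + 1) p q ≤ subdominant lev d k p q := by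
  rw [subdominant]
  split_ifs
  · exact min_le_left _ _
  · exact le_rfl

theorem subdominant_succ_le_max {k p q : ℕ} (hp : lev p = lev k) (hq : lev q = lev k) :
    subdominant lev d (k + 1) p q ≤ max (subdominant lev d k p k) (subdominant lev d k k q) := by
  rw [subdominant, if_pos ⟨hp, hq⟩]
  exact min_le_right _ _

/-- After stage `k`, the ultrametric inequality holds with all middle points below `k`. -/
theorem subdominant_ultra {k p q r : ℕ} (hr : r < k) (hp : lev p = lev r) (hq : lev q = lev r) :
    subdominant lev d k p q ≤ max (subdominant lev d k p r) (subdominant lev d k r q) := by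
  induction k generalizing p q r with
  | zero => omega
  | succ k ih =>
    obtain rfl | hrk : r = k ∨ r < k := by omega
    · rw [subdominant_succ_row, subdominant_succ_col]
      exact subdominant_succ_le_max hp hq
    · by_cases hk : lev r = lev k
      · have hpq := subdominant_succ_le_max (d := d) (hp.trans hk) (hq.trans hk)
        have hpq' := (subdominant_succ_le (lev := lev) (d := d) k p q).trans (ih hrk hp hq)
        have h₁ := ih (p := k) hrk hk.symm hq
        have h₂ := ih (q := k) hrk hp hk.symm
        -- Whichever of the two paths are rerouted through `k`, one of `hpq`, `hpq'` applies.
        have h₃ : subdominant lev d (k + 1) p r =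
            min (subdominant lev d k p r)
              (max (subdominant lev d k p k) (subdominant lev d k k r)) :=
          if_pos ⟨hp.trans hk, hk⟩
        have h₄ : subdominant lev d (k + 1) r q =
            min (subdominant lev d k r q)
              (max (subdominant lev d k r k) (subdominant lev d k k q)) :=
          if_pos ⟨hk, hq.trans hk⟩
        grind
      · rw [subdominant, subdominant, subdominant, if_neg (fun h => hk (hp ▸ h.1)),
          if_neg (fun h => hk h.2), if_neg (fun h => hk h.1)]
        exact ih hrk hp hq

/-- An ultrametric `μ ≤ d + χ` on the points of one level is at most the subdominant ultrametric
plus `χ`. -/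
theorem le_subdominant_add {α : Type*} {n : ℕ} {f : α → ℕ} {μ : α → α → ℝ} {χ : ℝ}
    (hμ : ∀ x y z, μ x z ≤ max (μ x y) (μ y z)) (hd : ∀ x y, μ x y ≤ d (f x) (f y) + χ)
    (hf : ∀ x, ∀ k < n, lev (f x) = lev k → ∃ y, f y = k) {k : ℕ} (hk : k ≤ n) (x y : α) :
    μ x y ≤ subdominant lev d k (f x) (f y) + χ := by
  induction k generalizing x y with
  | zero => exact hd x y
  | succ k ih =>
    rw [subdominant]
    split_ifs with h
    · obtain ⟨z, hz⟩ := hf x k hk h.1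
      have h₁ := ih (by omega) x y
      have h₂ := ih (by omega) x z
      have h₃ := ih (by omega) z y
      have h₄ := hμ x z y
      rw [hz] at h₂ h₃
      grind
    · exact ih (by omega) x y

end subdominant

/-- Copy an entry of the distance matrix to real array `1`. -/
def copyBody : Prog :=
  .setReal 1 (counter 5) (counter 6) (.read 0 (counter 5) (counter 6))

theorem copy_spec {n : ℕ} {s₀ : Memory} (hn : 1 ≤ n) (hsize : s₀.nat 0 0 0 = n) :
    Terminates (forPairs copyBody) s₀ (n * (n * (copyBody.bound + 30) + 30))
      (fun s => ∀ x < n, ∀ y < n, s.real 1 x y = s₀.real 0 x y) := by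
  refine forPairs_update (s₀.real 0) trivial hn hsize rfl fun i hi j hj s hs hsi hsj h x y => ?_
  have h0 := hs.real 0 (by simp [forPairs, forLoop, Prog.realWrites, copyBody])
  simp [copyBody, Prog.run, RExp.eval, Memory.setReal_real, hsi, hsj, h0]

/-- One entry of a Floyd–Warshall stage; the stage is in the counter array `4`. -/
def relaxBody : Prog :=
  .ite (.conj (.natEq (lvl (counter 5)) (lvl (counter 4)))
      (.natEq (lvl (counter 6)) (lvl (counter 4))))
    (.ite (.realLe (.read 1 (counter 5) (counter 4)) (.read 1 (counter 4) (counter 6)))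
      (.ite (.realLe (.read 1 (counter 5) (counter 6)) (.read 1 (counter 4) (counter 6)))
        .skip
        (.setReal 1 (counter 5) (counter 6) (.read 1 (counter 4) (counter 6))))
      (.ite (.realLe (.read 1 (counter 5) (counter 6)) (.read 1 (counter 5) (counter 4)))
        .skip
        (.setReal 1 (counter 5) (counter 6) (.read 1 (counter 5) (counter 4)))))
    .skip

theorem relax_spec {n k : ℕ} {s₀ : Memory} {d : ℕ → ℕ → ℝ} (hn : 1 ≤ n) (hsize : s₀.nat 0 0 0 = n)
    (hk : k < n) (hsk : s₀.nat 4 0 0 = k)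
    (hd : ∀ x < n, ∀ y < n, s₀.real 1 x y = subdominant (s₀.nat 1 · 0) d k x y) :
    Terminates (forPairs relaxBody) s₀ (n * (n * (relaxBody.bound + 30) + 30))
      (fun s => ∀ x < n, ∀ y < n, s.real 1 x y = subdominant (s₀.nat 1 · 0) d (k + 1) x y) := by
  refine forPairs_update _ (by simp [relaxBody, Prog.LoopFree]) hn hsize rfl
    fun i hi j hj s hs hsi hsj h x y => ?_
  have h1 := hs.nat 1 (by simp [forPairs, forLoop, Prog.natWrites, relaxBody])
  have h4 := hs.nat 4 (by simp [forPairs, forLoop, Prog.natWrites, relaxBody])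
  -- The entries in row and column `k` have their old values, whether overwritten or not.
  have hik : s.real 1 i k = subdominant (s₀.nat 1 · 0) d k i k := by
    rw [h i hi k hk, hd i hi k hk, subdominant_succ_col, ite_self]
  have hkj : s.real 1 k j = subdominant (s₀.nat 1 · 0) d k k j := by
    rw [h k hk j hj, hd k hk j hj, subdominant_succ_row, ite_self]
  have hij : s.real 1 i j = subdominant (s₀.nat 1 · 0) d k i j := by
    rw [h i hi j hj, hd i hi j hj, if_neg (by omega)]
  rw [subdominant, ← hik, ← hkj, ← hij]
  simp only [relaxBody, Prog.run, Test.Holds, Test.natEq_holds, lvl_eval, counter_eval, RExp.eval,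
    h1, h4, hsi, hsj, hsk]
  split_ifs <;> grind [Memory.setReal_real]

/-- All stages of the Floyd–Warshall recursion. -/
def relaxLoop : Prog := forLoop 4 (forPairs relaxBody)

theorem relaxLoop_spec {n : ℕ} {s₀ : Memory} (hn : 1 ≤ n) (hsize : s₀.nat 0 0 0 = n)
    (hd : ∀ x < n, ∀ y < n, s₀.real 1 x y = s₀.real 0 x y) :
    Terminates relaxLoop s₀ (n * (n * (n * (relaxBody.bound + 30) + 30) + 30))
      (fun s => ∀ x < n, ∀ y < n, s.real 1 x y =
        subdominant (s₀.nat 1 · 0) (s₀.real 0) n x y) := by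
  refine forLoop_spec (fun k s => ∀ x < n, ∀ y < n, s.real 1 x y =
    subdominant (s₀.nat 1 · 0) (s₀.real 0) k x y) hn hsize (by decide) (by decide) (by decide)
    (fun _ _ _ h => h) hd fun k hk s hs hsk h => ?_
  have h1 : s.nat 1 = s₀.nat 1 := hs.nat 1 (by decide)
  refine (relax_spec hn ((congrFun₂ (hs.nat 0 (by decide)) 0 0).trans hsize) hk hsk
    (by rw [h1]; exact h)).mono le_rfl fun s' _ h' => ?_
  rw [h1] at h'
  exact h'

/-- Update the maximal error of the subdominant ultrametric. -/
def errorBody : Prog :=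
  .ite (.natEq (lvl (counter 5)) (lvl (counter 6)))
    (.ite (.realLe (.sub (.read 0 (counter 5) (counter 6)) (.read 1 (counter 5) (counter 6)))
        (.read 2 (.const 0) (.const 0)))
      .skip
      (.setReal 2 (.const 0) (.const 0)
        (.sub (.read 0 (counter 5) (counter 6)) (.read 1 (counter 5) (counter 6)))))
    .skip

/-- The error is characterized as the least upper bound of `0` and of the errors within levels. -/
theorem error_spec {n : ℕ} {s₀ : Memory} (hn : 1 ≤ n) (hsize : s₀.nat 0 0 0 = n)
    (h2 : s₀.real 2 0 0 = 0) :
    Terminates (forPairs errorBody) s₀ (n * (n * (errorBody.bound + 30) + 30))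
      (fun s => 0 ≤ s.real 2 0 0 ∧
        (∀ x < n, ∀ y < n, s₀.nat 1 x 0 = s₀.nat 1 y 0 →
          s₀.real 0 x y - s₀.real 1 x y ≤ s.real 2 0 0) ∧
        ∀ b, 0 ≤ b → (∀ x < n, ∀ y < n, s₀.nat 1 x 0 = s₀.nat 1 y 0 →
          s₀.real 0 x y - s₀.real 1 x y ≤ b) → s.real 2 0 0 ≤ b) := by
  refine (forPairs_spec (fun i j s => 0 ≤ s.real 2 0 0 ∧
        (∀ x < n, ∀ y < n, x < i ∨ x = i ∧ y < j → s₀.nat 1 x 0 = s₀.nat 1 y 0 →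
          s₀.real 0 x y - s₀.real 1 x y ≤ s.real 2 0 0) ∧
        ∀ b, 0 ≤ b → (∀ x < n, ∀ y < n, s₀.nat 1 x 0 = s₀.nat 1 y 0 →
          s₀.real 0 x y - s₀.real 1 x y ≤ b) → s.real 2 0 0 ≤ b)
      (by simp [errorBody, Prog.LoopFree]) hn hsize (by decide) (fun _ _ _ _ _ _ h => h)
      ?_ ?_ ?_).mono le_rfl ?_
  · exact ⟨h2.ge, fun x _ y _ h => absurd h (by omega), fun b hb _ => h2.le.trans hb⟩
  · rintro i s ⟨h, h', h''⟩
    exact ⟨h, fun x hx y hy hxy => h' x hx y hy (by omega), h''⟩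
  · rintro i hi j hj s hs hsi hsj ⟨h, h', h''⟩
    have h1 := hs.nat 1 (by decide)
    have hr0 := hs.real 0 (by decide)
    have hr1 := hs.real 1 (by decide)
    have hxy : ∀ x y, x < i ∨ x = i ∧ y < j + 1 → (x < i ∨ x = i ∧ y < j) ∨ (x = i ∧ y = j) := by
      omega
    simp only [errorBody, Prog.run, Test.Holds, Test.natEq_holds, lvl_eval, counter_eval, RExp.eval,
      NExp.eval, h1, hr0, hr1, hsi, hsj]
    split_ifs with hl hle
    · refine ⟨h, fun x hx y hy hlt hl => ?_, h''⟩
      obtain hlt | ⟨rfl, rfl⟩ := hxy x y hlt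
      exacts [h' x hx y hy hlt hl, hle]
    · simp only [Memory.setReal_real, and_self, if_true]
      refine ⟨by linarith, fun x hx y hy hlt hl => ?_, fun b _ hb => hb i hi j hj hl⟩
      obtain hlt | ⟨rfl, rfl⟩ := hxy x y hlt
      exacts [(h' x hx y hy hlt hl).trans (not_le.1 hle).le, le_rfl]
    · refine ⟨h, fun x hx y hy hlt hl' => ?_, h''⟩
      obtain hlt | ⟨rfl, rfl⟩ := hxy x y hlt
      exacts [h' x hx y hy hlt hl', absurd hl' hl]
  · rintro s - ⟨h, h', h''⟩
    exact ⟨h, fun x hx y hy => h' x hx y hy (.inl hx), h''⟩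

/-- Add half of the maximal error off the diagonal. -/
def shiftBody : Prog :=
  .ite (.natEq (counter 5) (counter 6))
    (.setReal 1 (counter 5) (counter 6) (.const 0))
    (.setReal 1 (counter 5) (counter 6)
      (.add (.read 1 (counter 5) (counter 6))
        (.mul (.const (1 / 2)) (.read 2 (.const 0) (.const 0)))))

theorem shift_spec {n : ℕ} {s₀ : Memory} (hn : 1 ≤ n) (hsize : s₀.nat 0 0 0 = n) :
    Terminates (forPairs shiftBody) s₀ (n * (n * (shiftBody.bound + 30) + 30))
      (fun s => ∀ x < n, ∀ y < n, s.real 1 x y =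
        if x = y then 0 else s₀.real 1 x y + 1 / 2 * s₀.real 2 0 0) := by
  refine forPairs_update (fun x y => if x = y then 0 else s₀.real 1 x y + 1 / 2 * s₀.real 2 0 0)
    (by simp [shiftBody, Prog.LoopFree]) hn hsize rfl fun i hi j hj s hs hsi hsj h x y => ?_
  have h2 := hs.real 2 (by decide)
  have hij : s.real 1 i j = s₀.real 1 i j := by rw [h i hi j hj, if_neg (by omega)]
  simp only [shiftBody, Prog.run, Test.natEq_holds, counter_eval, RExp.eval, NExp.eval, hsi, hsj,
    h2, hij]
  split_ifs <;> simp_all [Memory.setReal_real]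

/-! ### Nearest neighbours and paths -/

/-- Update the table of nearest neighbours: cell `(p, l)` of array `7` is `0` if no point of level
`l` has been seen, and otherwise `r + 1`, where `r` is the point of level `l` nearest to `p`. -/
def nearestBody : Prog :=
  .ite (.conj (.natLe (.const 1) (.read 7 (counter 5) (lvl (counter 6))))
      (.realLe (.read 0 (counter 5) (.sub (.read 7 (counter 5) (lvl (counter 6))) (.const 1)))
        (.read 0 (counter 5) (counter 6))))
    .skip
    (.setNat 7 (counter 5) (lvl (counter 6)) (.add (counter 6) (.const 1)))

/-- `r` is a point of level `l` nearest to `p`, among the first `n` points. -/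
structure IsNearest (lev : ℕ → ℕ) (d : ℕ → ℕ → ℝ) (n p l r : ℕ) : Prop where
  lt : r < n
  lev_eq : lev r = l
  dist_le : ∀ q < n, lev q = l → d p r ≤ d p q

theorem nearest_spec {n : ℕ} {s₀ : Memory} (hn : 1 ≤ n) (hsize : s₀.nat 0 0 0 = n)
    (h7 : ∀ x y, s₀.nat 7 x y = 0) :
    Terminates (forPairs nearestBody) s₀ (n * (n * (nearestBody.bound + 30) + 30))
      (fun s => ∀ p < n, ∀ q < n, IsNearest (s₀.nat 1 · 0) (s₀.real 0) n p (s₀.nat 1 q 0)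
        (s.nat 7 p (s₀.nat 1 q 0) - 1)) := by
  -- While row `i` is being filled, its nonzero cells are nearest points among the first `j` ones,
  -- the rows above are final, and those below are still empty.
  refine (forPairs_spec (fun i j s => (∀ p < i, ∀ q < n,
        s.nat 7 p (s₀.nat 1 q 0) ≠ 0 ∧ IsNearest (s₀.nat 1 · 0) (s₀.real 0) n p (s₀.nat 1 q 0)
        (s.nat 7 p (s₀.nat 1 q 0) - 1)) ∧ (∀ q < j, s.nat 7 i (s₀.nat 1 q 0) ≠ 0) ∧
        (∀ l, s.nat 7 i l ≠ 0 → IsNearest (s₀.nat 1 · 0) (s₀.real 0) j i l (s.nat 7 i l - 1)) ∧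
        ∀ p, i < p → ∀ l, s.nat 7 p l = 0)
      (by simp [nearestBody, Prog.LoopFree]) hn hsize (by decide) ?_ ?_ ?_ ?_).mono le_rfl ?_
  · rintro i j s c v (rfl | rfl) h
    all_goals simpa [Memory.setNat_nat] using h
  · simp [h7]
  · rintro i s ⟨h₁, h₂, h₃, h₄⟩
    refine ⟨fun p hp q hq => ?_, by simp, fun l hl => absurd (h₄ _ (by omega) l) hl,
      fun p hp => h₄ p (by omega)⟩
    obtain rfl | hp : p = i ∨ p < i := by omega
    exacts [⟨h₂ q hq, h₃ _ (h₂ q hq)⟩, h₁ p hp q hq]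
  · rintro i hi j hj s hs hsi hsj ⟨h₁, h₂, h₃, h₄⟩
    have hl := hs.nat 1 (by decide)
    have hd := hs.real 0 (by decide)
    simp only [nearestBody, Prog.run, Test.Holds, lvl_eval, counter_eval, RExp.eval,
      NExp.eval, hl, hd, hsi, hsj]
    split_ifs with hle
    · refine ⟨h₁, fun q hq => ?_, fun l hl => ?_, h₄⟩
      · obtain rfl | hq : q = j ∨ q < j := by omega
        exacts [by omega, h₂ q hq]
      · obtain ⟨h, h', h''⟩ := h₃ l hl
        refine ⟨by omega, h', fun q hq hql => ?_⟩
        obtain rfl | hq : q = j ∨ q < j := by omega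
        exacts [by rw [← hql]; exact hle.2, h'' q hq hql]
    · simp only [Memory.setNat_nat, true_and]
      refine ⟨fun p hp q hq => ?_, fun q hq => ?_, fun l hl => ?_, fun p hp l => ?_⟩
      · rw [if_neg (by omega)]
        exact h₁ p hp q hq
      · split_ifs with h
        · omega
        · refine h₂ q ?_
          obtain rfl | hq : q = j ∨ q < j := by omega
          exacts [absurd rfl h, hq]
      · split_ifs at hl ⊢ with h
        · refine ⟨by omega, h.symm, fun q hq hql => ?_⟩
          simp only [Nat.add_sub_cancel]
          obtain rfl | hq : q = j ∨ q < j := by omega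
          · exact le_rfl
          · have h0 : s.nat 7 i (s₀.nat 1 j 0) ≠ 0 := by
              rw [← h, ← hql]
              exact h₂ q hq
            rw [not_and, not_le] at hle
            exact (hle (Nat.one_le_iff_ne_zero.2 h0)).le.trans
              ((h₃ _ h0).dist_le q hq (by rw [hql, h]))
        · obtain ⟨h₅, h₆, h₇⟩ := h₃ l hl
          refine ⟨by omega, h₆, fun q hq hql => ?_⟩
          obtain rfl | hq : q = j ∨ q < j := by omega
          exacts [absurd hql.symm h, h₇ q hq hql]
      · rw [if_neg (by omega)]
        exact h₄ p hp l
  · rintro s - ⟨h, -⟩ p hp q hq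
    exact (h p hp q hq).2

/-- Mark the current point of path `j` with the label `j`, and move on to its nearest neighbour in
the level given by `tgt`, if `b` holds. -/
def stepBody (b : Test) (tgt : NExp) : Prog :=
  .seq (.setNat 3 (counter 8) (counter 5) (.const 1))
    (.ite b (.setNat 8 (.const 0) (.const 0)
      (.sub (.read 7 (counter 8) tgt) (.const 1))) .skip)

/-- Starting from the point `j` in the counter array `5`, repeat `stepBody`; there are as many steps
as there are points, which is at least the number of levels. -/
def walk (b : Test) (tgt : NExp) : Prog :=
  .seq (.setNat 8 (.const 0) (.const 0) (counter 5)) (forLoop 6 (stepBody b tgt))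

/-- If a step moves the current point by `F`, then a walk from `j` marks the iterates of `F`
at `j`. -/
theorem walk_spec {b : Test} {tgt : NExp} {n j : ℕ} {s₀ : Memory} (F : ℕ → ℕ) (hn : 1 ≤ n)
    (hsize : s₀.nat 0 0 0 = n) (hj : s₀.nat 5 0 0 = j)
    (hF : ∀ s p, s.nat 0 = s₀.nat 0 → s.nat 1 = s₀.nat 1 → s.nat 7 = s₀.nat 7 →
      s.nat 8 0 0 = p →
      (b.Holds s → F p = s.nat 7 p (tgt.eval s) - 1) ∧ (¬ b.Holds s → F p = p)) :
    Terminates (walk b tgt) s₀ (6 + n * ((stepBody b tgt).bound + 30))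
      (fun s => ∀ q j', s.nat 3 q j' = 1 ↔
        s₀.nat 3 q j' = 1 ∨ j' = j ∧ ∃ m < n, F^[m] j = q) := by
  refine .seq (Q := fun s => s.nat 8 0 0 = j) ⟨_, _, .setNat _ _ _ _ _,
    by simp [NExp.cost, counter], by simp [Memory.setNat_nat, NExp.eval, hj]⟩ fun s₁ hs₁ h8 => ?_
  have hu : ∀ a, a ≠ 8 → s₁.nat a = s₀.nat a := fun a ha => hs₁.nat a (by simpa [Prog.natWrites])
  have hu' : ∀ s, Unchanged (forLoop 6 (stepBody b tgt)) s₁ s →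
      ∀ a, a ≠ 8 → a ≠ 3 → a ≠ 6 → s.nat a = s₀.nat a := fun s hs a ha ha' ha'' =>
    (hs.nat a (by simp [stepBody, forLoop, Prog.natWrites, ha, ha', ha''])).trans (hu a ha)
  refine (forLoop_spec (fun m s => s.nat 8 0 0 = F^[m] j ∧ ∀ q j', s.nat 3 q j' = 1 ↔
        s₀.nat 3 q j' = 1 ∨ j' = j ∧ ∃ m' < m, F^[m'] j = q) hn
        (by rw [hu 0 (by decide), hsize]) (by simp [stepBody, Prog.natWrites])
        (by simp [stepBody, Prog.natWrites]) (by decide) ?_ ?_ ?_).mono le_rfl fun s _ h => h.2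
  · intro m s v h
    simpa [Memory.setNat_nat] using h
  · simp [h8, hu 3]
  · rintro m hm s hs - ⟨h, h'⟩
    have h5 : s.nat 5 0 0 = j := by rw [hu' s hs 5 (by decide) (by decide) (by decide), hj]
    have h7 := hu' s hs 7 (by decide) (by decide) (by decide)
    have hlab : ∀ q j', (s.setNat 3 (F^[m] j) j 1).nat 3 q j' = 1 ↔
        s₀.nat 3 q j' = 1 ∨ j' = j ∧ ∃ m' < m + 1, F^[m'] j = q := by
      intro q j'
      simp only [Memory.setNat_nat, true_and, Order.lt_add_one_iff]
      split_ifs with hq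
      · simp only [true_iff]
        exact .inr ⟨hq.2, m, le_rfl, hq.1.symm⟩
      · rw [h']
        refine or_congr_right (and_congr_right fun hj' =>
          exists_congr fun m' => and_congr_left fun hm' => ⟨le_of_lt, fun hle => ?_⟩)
        exact hle.lt_of_ne fun hmm => hq ⟨by rw [← hm', hmm], hj'⟩
    refine Prog.LoopFree.terminates (by simp [stepBody, Prog.LoopFree]) ?_
    have hF' := hF (s.setNat 3 (F^[m] j) j 1) (F^[m] j)
      (by funext x y; simp [Memory.setNat_nat, hu' s hs 0])
      (by funext x y; simp [Memory.setNat_nat, hu' s hs 1])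
      (by funext x y; simp [Memory.setNat_nat, hu' s hs 7])
      (by simp [Memory.setNat_nat, h])
    have hmark : (Prog.setNat 3 (counter 8) (counter 5) (.const 1)).run s =
        s.setNat 3 (F^[m] j) j 1 := by simp [Prog.run, NExp.eval, h, h5]
    rw [stepBody, Prog.run, hmark, Prog.run, Function.iterate_succ_apply']
    split_ifs with hb
    · refine ⟨?_, fun q j' => ?_⟩
      · rw [hF'.1 hb]
        simp [Prog.run, NExp.eval, Memory.setNat_nat, h]
      · rw [← hlab]
        simp [Prog.run, NExp.eval, Memory.setNat_nat]
    · exact ⟨by rw [hF'.2 hb]; simp [Prog.run, Memory.setNat_nat, h], hlab⟩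

/-- From a point, move to its nearest neighbour in the next level, as long as there is one. -/
def succWalk : Prog :=
  walk (.neg (.natLe (.read 0 (.const 0) (.const 1)) (.add (lvl (counter 8)) (.const 1))))
    (.add (lvl (counter 8)) (.const 1))

/-- From a point, move to its nearest neighbour in the previous level, as long as there is one. -/
def predWalk : Prog :=
  walk (.natLe (.const 1) (lvl (counter 8))) (.sub (lvl (counter 8)) (.const 1))

/-- The next point on a forward path, read off the table of nearest neighbours. -/
def next (s : Memory) (p : ℕ) : ℕ :=
  if s.nat 1 p 0 + 1 < s.nat 0 0 1 then s.nat 7 p (s.nat 1 p 0 + 1) - 1 else p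

/-- The next point on a backward path, read off the table of nearest neighbours. -/
def prev (s : Memory) (p : ℕ) : ℕ :=
  if 1 ≤ s.nat 1 p 0 then s.nat 7 p (s.nat 1 p 0 - 1) - 1 else p

/-- For every point `j`, mark the points on the forward and on the backward walk from `j`. -/
def labelLoop : Prog := forLoop 5 (.seq succWalk predWalk)

theorem labelLoop_spec : ∃ c, ∀ {n : ℕ} {s₀ : Memory}, 1 ≤ n → s₀.nat 0 0 0 = n →
    (∀ x y, s₀.nat 3 x y = 0) →
    Terminates labelLoop s₀ (n * (n * c))
      (fun s => ∀ q j, s.nat 3 q j = 1 ↔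
        j < n ∧ ∃ m < n, (next s₀)^[m] j = q ∨ (prev s₀)^[m] j = q) := by
  obtain ⟨c₁, hc₁⟩ : ∃ c₁, ∀ {n j : ℕ} {s : Memory}, 1 ≤ n → s.nat 0 0 0 = n → s.nat 5 0 0 = j →
      Terminates succWalk s (6 + n * c₁) (fun s' => ∀ q j', s'.nat 3 q j' = 1 ↔
        s.nat 3 q j' = 1 ∨ j' = j ∧ ∃ m < n, (next s)^[m] j = q) := by
    refine ⟨_, fun hn hs hj => walk_spec (next _) hn hs hj fun s p h0 h1 h7 h8 => ?_⟩
    simp only [Test.Holds, NExp.eval, lvl_eval, counter_eval, next, h0, h1, h7, h8, not_le, not_lt]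
    exact ⟨fun h => by rw [if_pos h], fun h => by rw [if_neg (by omega)]⟩
  obtain ⟨c₂, hc₂⟩ : ∃ c₂, ∀ {n j : ℕ} {s : Memory}, 1 ≤ n → s.nat 0 0 0 = n → s.nat 5 0 0 = j →
      Terminates predWalk s (6 + n * c₂) (fun s' => ∀ q j', s'.nat 3 q j' = 1 ↔
        s.nat 3 q j' = 1 ∨ j' = j ∧ ∃ m < n, (prev s)^[m] j = q) := by
    refine ⟨_, fun hn hs hj => walk_spec (prev _) hn hs hj fun s p h0 h1 h7 h8 => ?_⟩
    simp only [Test.Holds, NExp.eval, lvl_eval, counter_eval, prev, h1, h7, h8]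
    exact ⟨fun h => by rw [if_pos h], fun h => by rw [if_neg h]⟩
  refine ⟨c₁ + c₂ + 42, fun {n s₀} hn hsize h3 => ?_⟩
  refine (forLoop_spec (fun j s => ∀ q j', s.nat 3 q j' = 1 ↔
      j' < j ∧ ∃ m < n, (next s₀)^[m] j' = q ∨ (prev s₀)^[m] j' = q)
      (B := 6 + n * c₁ + (6 + n * c₂)) hn hsize (by decide) (by decide)
      (by decide) ?_ ?_ ?_).mono ?_ fun _ _ h => h
  · intro j s v h
    simpa [Memory.setNat_nat] using h
  · simp [h3]
  · intro j hj s hs hsj h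
    have hsn : ∀ {s s' : Memory}, s'.nat 0 = s.nat 0 → s'.nat 1 = s.nat 1 → s'.nat 7 = s.nat 7 →
        next s' = next s ∧ prev s' = prev s := by
      intro s s' h0 h1 h7
      exact ⟨funext fun p => by simp only [next, h0, h1, h7],
        funext fun p => by simp only [prev, h1, h7]⟩
    have hs0 := hs.nat 0 (by decide)
    obtain ⟨hns, hps⟩ := hsn hs0 (hs.nat 1 (by decide)) (hs.nat 7 (by decide))
    refine (hc₁ hn (by rw [hs0, hsize]) hsj).seq fun s₁ hs₁ h₁ => ?_
    have hs10 := hs₁.nat 0 (by decide)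
    obtain ⟨-, hps₁⟩ := hsn hs10 (hs₁.nat 1 (by decide)) (hs₁.nat 7 (by decide))
    refine (hc₂ (j := j) hn (by rw [hs10, hs0, hsize])
      (by rw [hs₁.nat 5 (by decide), hsj])).mono le_rfl fun s₂ _ h₂ q j' => ?_
    rw [h₂, h₁, h, hps₁, hps, hns]
    constructor
    · rintro ((⟨hlt, hm⟩ | ⟨rfl, m, hm, h⟩) | ⟨rfl, m, hm, h⟩)
      exacts [⟨by omega, hm⟩, ⟨by omega, m, hm, .inl h⟩, ⟨by omega, m, hm, .inr h⟩]
    · rintro ⟨hlt, m, hm, hmem⟩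
      obtain rfl | hlt : j' = j ∨ j' < j := by omega
      · exact hmem.elim (fun h => .inl (.inr ⟨rfl, m, hm, h⟩)) fun h => .inr ⟨rfl, m, hm, h⟩
      · exact .inl (.inl ⟨hlt, m, hm, hmem⟩)
  · refine Nat.mul_le_mul_left n ?_
    nlinarith

/-- What is needed of the functions `F`, `B` that lead from a point to a nearest point in the next
and in the previous level: points of the last level are fixed by `F`, and those of the first level
by `B`. -/
structure IsNeighbourPair (lev : ℕ → ℕ) (d : ℕ → ℕ → ℝ) (n t : ℕ) (F B : ℕ → ℕ) : Prop where
  succ : ∀ p < n, lev p + 1 < t → IsNearest lev d n p (lev p + 1) (F p)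
  succ_last : ∀ p < n, ¬ lev p + 1 < t → F p = p
  pred : ∀ p < n, 1 ≤ lev p → IsNearest lev d n p (lev p - 1) (B p)
  pred_first : ∀ p < n, ¬ 1 ≤ lev p → B p = p

/-- The point in level `l` of the path through `j`. -/
def pathPoint (lev F B : ℕ → ℕ) (j l : ℕ) : ℕ :=
  if lev j ≤ l then F^[l - lev j] j else B^[lev j - l] j

theorem pathPoint_self (lev F B : ℕ → ℕ) (j : ℕ) : pathPoint lev F B j (lev j) = j := by
  simp [pathPoint]

/-- Above the level of `j` the path follows `F`, and below it, read upwards, it undoes `B`. -/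
theorem pathPoint_step (lev F B : ℕ → ℕ) (j l : ℕ) :
    F (pathPoint lev F B j l) = pathPoint lev F B j (l + 1) ∨
      B (pathPoint lev F B j (l + 1)) = pathPoint lev F B j l := by
  obtain h | h | h : lev j ≤ l ∨ lev j = l + 1 ∨ l + 1 < lev j := by omega
  · left
    rw [pathPoint, pathPoint, if_pos h, if_pos (by omega), Nat.succ_sub h,
      Function.iterate_succ_apply']
  · right
    rw [← h, pathPoint_self, pathPoint, if_neg (by omega), show lev j - l = 1 by omega]
    rfl
  · right
    rw [pathPoint, pathPoint, if_neg (by omega), if_neg (by omega),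
      show lev j - l = (lev j - (l + 1)) + 1 by omega, Function.iterate_succ_apply']

namespace IsNeighbourPair

variable {lev : ℕ → ℕ} {d : ℕ → ℕ → ℝ} {n t : ℕ} {F B : ℕ → ℕ}

/-- Every forward iterate equals one that is reached by strictly climbing `m'` levels: iterates that
stay in the last level repeat earlier ones. -/
theorem iterate_succ (h : IsNeighbourPair lev d n t F B) {j : ℕ} (hj : j < n) (m : ℕ) :
    F^[m] j < n ∧ ∃ m', F^[m] j = F^[m'] j ∧ lev (F^[m] j) = lev j + m' := by
  induction m with
  | zero => exact ⟨hj, 0, rfl, rfl⟩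
  | succ m ih =>
    obtain ⟨hlt, m', hm, hl⟩ := ih
    rw [Function.iterate_succ_apply']
    by_cases ht : lev (F^[m] j) + 1 < t
    · have := h.succ _ hlt ht
      exact ⟨this.lt, m' + 1, by rw [Function.iterate_succ_apply', hm],
        by rw [this.lev_eq, hl, add_assoc]⟩
    · rw [h.succ_last _ hlt ht]
      exact ⟨hlt, m', hm, hl⟩

/-- Every backward iterate equals one that is reached by strictly descending `m'` levels. -/
theorem iterate_pred (h : IsNeighbourPair lev d n t F B) {j : ℕ} (hj : j < n) (m : ℕ) :
    B^[m] j < n ∧ ∃ m', B^[m] j = B^[m'] j ∧ lev (B^[m] j) + m' = lev j := by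
  induction m with
  | zero => exact ⟨hj, 0, rfl, rfl⟩
  | succ m ih =>
    obtain ⟨hlt, m', hm, hl⟩ := ih
    rw [Function.iterate_succ_apply']
    by_cases ht : 1 ≤ lev (B^[m] j)
    · have := h.pred _ hlt ht
      exact ⟨this.lt, m' + 1, by rw [Function.iterate_succ_apply', hm],
        by rw [this.lev_eq]; omega⟩
    · rw [h.pred_first _ hlt ht]
      exact ⟨hlt, m', hm, hl⟩

/-- The path through `j` runs through all levels. -/
theorem pathPoint_spec (h : IsNeighbourPair lev d n t F B) {j l : ℕ} (hj : j < n) (hl : l < t) :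
    pathPoint lev F B j l < n ∧ lev (pathPoint lev F B j l) = l := by
  have hup : ∀ m, lev j + m < t → lev (F^[m] j) = lev j + m := by
    intro m hm
    induction m with
    | zero => rfl
    | succ m ih =>
      have ih := ih (by omega)
      rw [Function.iterate_succ_apply', (h.succ _ (h.iterate_succ hj m).1 (by omega)).lev_eq, ih]
      rfl
  have hdown : ∀ m, m ≤ lev j → lev (B^[m] j) = lev j - m := by
    intro m hm
    induction m with
    | zero => rfl
    | succ m ih =>
      have ih := ih (by omega)
      rw [Function.iterate_succ_apply', (h.pred _ (h.iterate_pred hj m).1 (by omega)).lev_eq, ih]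
      rfl
  rw [pathPoint]
  split_ifs with hjl
  · exact ⟨(h.iterate_succ hj _).1, by rw [hup _ (by omega)]; omega⟩
  · exact ⟨(h.iterate_pred hj _).1, by rw [hdown _ (by omega)]; omega⟩

/-- The points visited by the two walks from `j` are exactly those of the path through `j`. -/
theorem visited_iff (h : IsNeighbourPair lev d n t F B) (htn : t ≤ n) {j q : ℕ}
    (hj : j < n) (hjt : lev j < t) (hqt : lev q < t) :
    (∃ m < n, F^[m] j = q ∨ B^[m] j = q) ↔ pathPoint lev F B j (lev q) = q := by
  constructor
  · rintro ⟨m, -, rfl | rfl⟩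
    · obtain ⟨-, m', hm, hl⟩ := h.iterate_succ hj m
      rw [pathPoint, if_pos (by omega), show lev (F^[m] j) - lev j = m' by omega, hm]
    · obtain ⟨-, m', hm, hl⟩ := h.iterate_pred hj m
      rw [pathPoint]
      split_ifs with hle
      · obtain rfl : m' = 0 := by omega
        rw [hm, show lev (B^[0] j) - lev j = 0 by simp]
        rfl
      · rw [show lev j - lev (B^[m] j) = m' by omega, hm]
  · intro hq
    rw [pathPoint] at hq
    split_ifs at hq with hle
    · exact ⟨_, by omega, .inl hq⟩
    · exact ⟨_, by omega, .inr hq⟩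

end IsNeighbourPair

/-! ### The algorithm -/

/-- The clustering algorithm. Natural number arrays: `4`, `5`, `6` hold loop counters, `7` the table
of nearest neighbours, and `8` the current point of a path. Cell `(0, 0)` of real array `2` holds
the maximal error of the subdominant ultrametric. -/
def clusteringProgram : Prog :=
  .seq (forPairs copyBody) <| .seq relaxLoop <| .seq (forPairs errorBody) <|
    .seq (forPairs shiftBody) <| .seq (forPairs nearestBody) <| .seq labelLoop <|
    .setNat 2 (.const 0) (.const 0) (counter 0)

/-- What the algorithm computes, in terms of the input arrays. The number `ε` is the least upper
bound of `0` and of the errors of the subdominant ultrametric within levels. -/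
theorem clusteringProgram_spec : ∃ c, ∀ {n t : ℕ} {s₀ : Memory}, 1 ≤ n → s₀.nat 0 0 0 = n →
    s₀.nat 0 0 1 = t → (∀ l < t, ∃ q < n, s₀.nat 1 q 0 = l) → (∀ q < n, s₀.nat 1 q 0 < t) →
    (∀ x y, s₀.nat 3 x y = 0) → (∀ x y, s₀.nat 7 x y = 0) → s₀.real 2 0 0 = 0 →
    Terminates clusteringProgram s₀ (c * n ^ 3) fun s =>
      outK s = n ∧
      (∃ ε, 0 ≤ ε ∧
        (∀ x < n, ∀ y < n, s₀.nat 1 x 0 = s₀.nat 1 y 0 →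
          s₀.real 0 x y - subdominant (s₀.nat 1 · 0) (s₀.real 0) n x y ≤ ε) ∧
        (∀ b, 0 ≤ b → (∀ x < n, ∀ y < n, s₀.nat 1 x 0 = s₀.nat 1 y 0 →
          s₀.real 0 x y - subdominant (s₀.nat 1 · 0) (s₀.real 0) n x y ≤ b) → ε ≤ b) ∧
        ∀ x < n, ∀ y < n, s.real 1 x y =
          if x = y then 0 else subdominant (s₀.nat 1 · 0) (s₀.real 0) n x y + 1 / 2 * ε) ∧
      ∃ F B, IsNeighbourPair (s₀.nat 1 · 0) (s₀.real 0) n t F B ∧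
        ∀ q j, s.nat 3 q j = 1 ↔ j < n ∧ ∃ m < n, F^[m] j = q ∨ B^[m] j = q := by
  obtain ⟨c, hc⟩ := labelLoop_spec
  refine ⟨copyBody.bound + 60 + (relaxBody.bound + 90) + (errorBody.bound + 60) +
    (shiftBody.bound + 60) + (nearestBody.bound + 60) + c + 10,
    fun {n t s₀} hn hsize ht hne hlt h3 h7 hr2 => ?_⟩
  have hsize' : ∀ s : Memory, s.nat 0 = s₀.nat 0 → s.nat 0 0 0 = n := fun s h => by rw [h, hsize]
  -- The time bound of one pass over all pairs of points.
  let pass (p : Prog) : ℕ := n * (n * (p.bound + 30) + 30)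
  refine Terminates.mono (B := pass copyBody + (n * (pass relaxBody + 30) + (pass errorBody +
    (pass shiftBody + (pass nearestBody + (n * (n * c) +
      (Prog.setNat 2 (.const 0) (.const 0) (counter 0)).bound)))))) ?_ ?_ fun _ _ h => h
  · refine (copy_spec hn hsize).seq fun s₁ u₁ h₁ => ?_
    have n₁ : ∀ a, a ≠ 5 → a ≠ 6 → s₁.nat a = s₀.nat a := fun a h h' => u₁.nat a (by
      simp [forPairs, forLoop, copyBody, Prog.natWrites, h, h'])
    have r₁ : ∀ a, a ≠ 1 → s₁.real a = s₀.real a := fun a h => u₁.real a (by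
      simp [forPairs, forLoop, copyBody, Prog.realWrites, h])
    refine (relaxLoop_spec hn (hsize' s₁ (n₁ 0 (by decide) (by decide)))
      (by rw [r₁ 0 (by decide)]; exact h₁)).seq fun s₂ u₂ h₂ => ?_
    rw [n₁ 1 (by decide) (by decide), r₁ 0 (by decide)] at h₂
    have n₂ : ∀ a, a ≠ 4 → a ≠ 5 → a ≠ 6 → s₂.nat a = s₀.nat a := fun a h h' h'' =>
      (u₂.nat a (by simp [relaxLoop, forPairs, forLoop, relaxBody, Prog.natWrites, h, h', h''])).trans
        (n₁ a h' h'')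
    have r₂ : ∀ a, a ≠ 1 → s₂.real a = s₀.real a := fun a h =>
      (u₂.real a (by simp [relaxLoop, forPairs, forLoop, relaxBody, Prog.realWrites, h])).trans
        (r₁ a h)
    refine (error_spec hn (hsize' s₂ (n₂ 0 (by decide) (by decide) (by decide)))
      (by rw [r₂ 2 (by decide), hr2])).seq fun s₃ u₃ h₃ => ?_
    rw [n₂ 1 (by decide) (by decide) (by decide), r₂ 0 (by decide)] at h₃
    have n₃ : ∀ a, a ≠ 4 → a ≠ 5 → a ≠ 6 → s₃.nat a = s₀.nat a := fun a h h' h'' =>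
      (u₃.nat a (by simp [forPairs, forLoop, errorBody, Prog.natWrites, h', h''])).trans
        (n₂ a h h' h'')
    have r₃ : s₃.real 0 = s₀.real 0 := (u₃.real 0 (by decide)).trans (r₂ 0 (by decide))
    have r₃' : s₃.real 1 = s₂.real 1 := u₃.real 1 (by decide)
    refine (shift_spec hn (hsize' s₃ (n₃ 0 (by decide) (by decide) (by decide)))).seq
      fun s₄ u₄ h₄ => ?_
    rw [r₃'] at h₄
    have n₄ : ∀ a, a ≠ 4 → a ≠ 5 → a ≠ 6 → s₄.nat a = s₀.nat a := fun a h h' h'' =>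
      (u₄.nat a (by simp [forPairs, forLoop, shiftBody, Prog.natWrites, h', h''])).trans
        (n₃ a h h' h'')
    have r₄ : s₄.real 0 = s₀.real 0 := (u₄.real 0 (by decide)).trans r₃
    refine (nearest_spec hn (hsize' s₄ (n₄ 0 (by decide) (by decide) (by decide)))
      (by rw [n₄ 7 (by decide) (by decide) (by decide)]; exact h7)).seq fun s₅ u₅ h₅ => ?_
    rw [n₄ 1 (by decide) (by decide) (by decide), r₄] at h₅
    have n₅ : ∀ a, a ≠ 4 → a ≠ 5 → a ≠ 6 → a ≠ 7 → s₅.nat a = s₀.nat a := fun a h h' h'' h7 =>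
      (u₅.nat a (by simp [forPairs, forLoop, nearestBody, Prog.natWrites, h', h'', h7])).trans
        (n₄ a h h' h'')
    have n₅₀ := n₅ 0 (by decide) (by decide) (by decide) (by decide)
    have n₅₁ := n₅ 1 (by decide) (by decide) (by decide) (by decide)
    have r₅ : s₅.real 1 = s₄.real 1 := u₅.real 1 (by decide)
    refine (hc hn (hsize' s₅ n₅₀) (by
      rw [n₅ 3 (by decide) (by decide) (by decide) (by decide)]; exact h3)).seq fun s₆ u₆ h₆ => ?_
    have n₆ : s₆.nat 0 = s₀.nat 0 := (u₆.nat 0 (by decide)).trans n₅₀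
    refine Prog.LoopFree.terminates (p := .setNat 2 (.const 0) (.const 0) (counter 0)) trivial
      ⟨?_, ⟨s₃.real 2 0 0, h₃.1, fun x hx y hy hxy => ?_,
      fun b hb hxy => h₃.2.2 b hb fun x hx y hy h => ?_, fun x hx y hy => ?_⟩,
      next s₅, prev s₅, ⟨fun p hp hpt => ?_, fun p hp hpt => ?_, fun p hp hpt => ?_,
        fun p hp hpt => ?_⟩, fun q j => ?_⟩
    · simp [outK, Prog.run, NExp.eval, Memory.setNat_nat, n₆, hsize]
    · rw [← h₂ x hx y hy]
      exact h₃.2.1 x hx y hy hxy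
    · rw [h₂ x hx y hy]
      exact hxy x hx y hy h
    · rw [← h₂ x hx y hy, ← h₄ x hx y hy, ← r₅, ← u₆.real 1 (by decide)]
      rfl
    · obtain ⟨q, hq, hql⟩ := hne _ hpt
      rw [next, if_pos (by rw [n₅₀, n₅₁, ht]; exact hpt), n₅₁, ← hql]
      exact h₅ p hp q hq
    · exact if_neg (by rw [n₅₀, n₅₁, ht]; exact hpt)
    · obtain ⟨q, hq, hql⟩ := hne (s₀.nat 1 p 0 - 1) (by have := hlt p hp; omega)
      rw [prev, if_pos (by rw [n₅₁]; exact hpt), n₅₁, ← hql]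
      exact h₅ p hp q hq
    · exact if_neg (by rw [n₅₁]; exact hpt)
    · rw [← h₆]
      simp [Prog.run, Memory.setNat_nat]
  · have h₁ : 1 ≤ n ^ 3 := Nat.one_le_pow _ _ hn
    have h₂ : n ≤ n ^ 3 := Nat.le_self_pow (by decide) n
    have h₃ : n * n ≤ n ^ 3 := by
      rw [← sq]
      exact Nat.pow_le_pow_right hn (by decide)
    have h₄ : ∀ b, n * (n * (b + 30) + 30) ≤ (b + 60) * n ^ 3 := by
      intro b
      nlinarith [Nat.mul_le_mul_left (b + 30) h₃]
    have h₅ : ∀ b, n * (n * (n * (b + 30) + 30) + 30) ≤ (b + 90) * n ^ 3 := by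
      intro b
      have : n * (n * (n * (b + 30) + 30) + 30) = (b + 30) * n ^ 3 + 30 * (n * n) + 30 * n := by
        ring
      linarith
    have h₆ : n * (n * c) ≤ c * n ^ 3 := by
      nlinarith [Nat.mul_le_mul_left c h₃]
    have h₇ : (Prog.setNat 2 (.const 0) (.const 0) (counter 0)).bound ≤ 10 := by decide
    have h₈ := Nat.mul_le_mul h₇ h₁
    simp only [pass]
    simp only [add_mul _ _ (n ^ 3)] at h₄ h₅ h₈ ⊢
    linarith [h₄ copyBody.bound, h₅ relaxBody.bound, h₄ errorBody.bound, h₄ shiftBody.bound,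
      h₄ nearestBody.bound]

/-! ### Clusterings -/

theorem isPseudoUltrametric_of {α : Type*} {μ : α → α → ℝ} (h₀ : ∀ x, μ x x = 0)
    (hc : ∀ x y, μ x y = μ y x) (hu : ∀ x y z, μ x z ≤ max (μ x y) (μ y z)) :
    IsPseudoUltrametric μ := by
  have hnn : ∀ x y, 0 ≤ μ x y := fun x y => by
    have := hu x y x
    rwa [h₀, hc y x, max_self] at this
  refine ⟨{ dist := μ, dist_self := h₀, dist_comm := hc, dist_triangle := fun x y z => ?_ },
    fun _ _ => rfl, ?_⟩
  · exact (hu x y z).trans (max_le_add_of_nonneg (hnn x y) (hnn y z))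
  · exact @IsUltrametricDist.mk α ⟨μ⟩ hu

theorem IsPseudoUltrametric.le_max {α : Type*} {μ : α → α → ℝ} (h : IsPseudoUltrametric μ)
    (x y z : α) : μ x z ≤ max (μ x y) (μ y z) := by
  obtain ⟨m, hm, hu⟩ := h
  rw [← hm, ← hm, ← hm]
  exact hu.dist_triangle_max x y z

theorem linfDist_le_iff {α : Type*} [Finite α] [Nonempty α] {μ ν : α → α → ℝ} {χ : ℝ} :
    linfDist μ ν ≤ χ ↔ ∀ x y, |μ x y - ν x y| ≤ χ := by
  rw [linfDist, ciSup_le_iff (Set.finite_range _).bddAbove, Prod.forall]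

section FromPathCover

variable {X : Type*} {t k : ℕ} {P : TemporalSampling X t} {C : P.Rel}
  {L : ∀ i, P.level i → Set (Fin k)}

theorem FromPathCover.isLabeling (h : FromPathCover P C L) (i : Fin t) : IsLabeling (L i) := by
  obtain ⟨τ, -, hτ, hL⟩ := h
  refine ⟨fun u => ?_, fun u v huv => ?_, ?_⟩
  · obtain ⟨j, hj⟩ := hτ i u
    exact ⟨j, by rwa [hL]⟩
  · rw [hL, hL, Set.disjoint_left]
    exact fun j hu hv => huv (hu.symm.trans hv)
  · exact Set.eq_univ_of_forall fun j => Set.mem_iUnion.2 ⟨τ j i, by rw [hL]; rfl⟩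

theorem FromPathCover.contiguous [MetricSpace X] (h : FromPathCover P C L) {δ : ℝ} {i : ℕ}
    {hi : i + 1 < t} (hC : IsLocal δ (C i hi)) :
    Contiguous δ (L ⟨i, Nat.lt_of_succ_lt hi⟩) (L ⟨i + 1, hi⟩) := by
  obtain ⟨τ, hτC, -, hL⟩ := h
  refine ⟨fun u j hj => ?_, fun v j hj => ?_⟩
  · rw [hL] at hj
    have := hC _ (hτC j i hi)
    obtain rfl : τ j _ = u := hj
    exact Set.mem_biUnion (x := τ j ⟨i + 1, hi⟩) (Metric.mem_closedBall'.2 this) (by rw [hL]; rfl)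
  · rw [hL] at hj
    have := hC _ (hτC j i hi)
    obtain rfl : τ j _ = v := hj
    exact Set.mem_biUnion (x := τ j ⟨i, Nat.lt_of_succ_lt hi⟩) (Metric.mem_closedBall.2 this)
      (by rw [hL]; rfl)

end FromPathCover

section Input

/-- Levels are non-empty, so a walk through all of them has at most `P.size` points. -/
theorem TemporalSampling.length_le_size {X : Type*} {t : ℕ} (P : TemporalSampling X t) :
    t ≤ P.size := by
  calc t = ∑ _i : Fin t, 1 := by simp
    _ ≤ P.size := Finset.sum_le_sum fun i _ => (P.nonempty i).card_pos

theorem symm_inj {X : Type*} {t : ℕ} {P : TemporalSampling X t}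
    {e : Fin P.size ≃ Σ i : Fin t, P.level i} {i : Fin t} {u v : P.level i}
    (h : (e.symm ⟨i, u⟩ : ℕ) = e.symm ⟨i, v⟩) : u = v := by
  have := e.symm.injective (Fin.ext h)
  simpa using this

variable {X : Type*} [MetricSpace X] {t : ℕ} {P : TemporalSampling X t}
  {e : Fin P.size ≃ Σ i : Fin t, P.level i}

theorem input_level (x : Fin P.size) : (input P e).nat 1 x 0 = (e x).1 := by
  simp [input]

theorem input_dist (x y : Fin P.size) :
    (input P e).real 0 x y = dist ((e x).2 : X) ((e y).2 : X) := by
  simp [input]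

theorem input_level_symm (i : Fin t) (u : P.level i) :
    (input P e).nat 1 (e.symm ⟨i, u⟩) 0 = i := by
  rw [input_level, Equiv.apply_symm_apply]

theorem input_dist_symm (i i' : Fin t) (u : P.level i) (v : P.level i') :
    (input P e).real 0 (e.symm ⟨i, u⟩) (e.symm ⟨i', v⟩) = dist (u : X) (v : X) := by
  rw [input_dist, Equiv.apply_symm_apply, Equiv.apply_symm_apply]

theorem exists_symm_eq {p : ℕ} {i : Fin t} (hp : p < P.size) (hi : (input P e).nat 1 p 0 = i) :
    ∃ u : P.level i, (e.symm ⟨i, u⟩ : ℕ) = p := by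
  have h : (e ⟨p, hp⟩).1 = i := by
    have := input_level (e := e) ⟨p, hp⟩
    exact Fin.ext (this.symm.trans hi)
  subst h
  exact ⟨(e ⟨p, hp⟩).2, by simp⟩

/-- The maximal error of the subdominant ultrametric is at most `2 * χ`. -/
theorem Admits.error_le {χ δ : ℝ} (h : Admits P χ δ) {x y : ℕ} (hx : x < P.size) (hy : y < P.size)
    (hxy : (input P e).nat 1 x 0 = (input P e).nat 1 y 0) :
    (input P e).real 0 x y -
      subdominant ((input P e).nat 1 · 0) ((input P e).real 0) P.size x y ≤ 2 * χ := by
  obtain ⟨μ, k, L, hcl⟩ := h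
  obtain ⟨i, hi⟩ : ∃ i : Fin t, (input P e).nat 1 x 0 = i := ⟨_, input_level ⟨x, hx⟩⟩
  obtain ⟨u, rfl⟩ := exists_symm_eq hx hi
  rw [input_level_symm] at hxy
  obtain ⟨v, rfl⟩ := exists_symm_eq hy hxy.symm
  have : Nonempty (P.level i) := (P.nonempty i).to_subtype
  have hfit := fun u v => abs_le.1 (linfDist_le_iff.1 (hcl.fit i) u v)
  have := le_subdominant_add (lev := ((input P e).nat 1 · 0)) (d := (input P e).real 0)
    (f := fun u : P.level i => (e.symm ⟨i, u⟩ : ℕ)) (μ := μ i) (χ := χ) (n := P.size)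
    (hcl.ultrametric i).le_max (fun u v => by
      rw [input_dist_symm]
      linarith [(hfit u v).1])
    (fun u k hk huk => exists_symm_eq hk (huk.symm.trans (input_level_symm i u))) le_rfl u v
  rw [input_dist_symm]
  linarith [(hfit u v).2]

/-- If `P` admits a clustering, then every point has a point of the next level within `δ`. -/
theorem Admits.exists_succ {χ δ : ℝ} (h : Admits P χ δ) {i : ℕ} (hi : i + 1 < t)
    (u : P.level ⟨i, Nat.lt_of_succ_lt hi⟩) :
    ∃ v : P.level ⟨i + 1, hi⟩, dist (u : X) (v : X) ≤ δ := by
  obtain ⟨μ, k, L, hcl⟩ := h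
  obtain ⟨j, hj⟩ := (hcl.labeling _).nonempty u
  obtain ⟨v, hv, -⟩ := Set.mem_iUnion₂.1 ((hcl.contiguous i hi).1 u hj)
  exact ⟨v, Metric.mem_closedBall'.1 hv⟩

/-- If `P` admits a clustering, then every point has a point of the previous level within `δ`. -/
theorem Admits.exists_pred {χ δ : ℝ} (h : Admits P χ δ) {i : ℕ} (hi : i + 1 < t)
    (v : P.level ⟨i + 1, hi⟩) :
    ∃ u : P.level ⟨i, Nat.lt_of_succ_lt hi⟩, dist (u : X) (v : X) ≤ δ := by
  obtain ⟨μ, k, L, hcl⟩ := h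
  obtain ⟨j, hj⟩ := (hcl.labeling _).nonempty v
  obtain ⟨u, hu, -⟩ := Set.mem_iUnion₂.1 ((hcl.contiguous i hi).2 v hj)
  exact ⟨u, Metric.mem_closedBall.1 hu⟩

/-- The relation between successive levels whose pairs consist of a point and its image under `F`,
or of a point and its image under `B`. -/
def neighbourRel (P : TemporalSampling X t) (e : Fin P.size ≃ Σ i : Fin t, P.level i)
    (F B : ℕ → ℕ) : P.Rel := fun _ _ =>
  {c | F (e.symm ⟨_, c.1⟩) = e.symm ⟨_, c.2⟩ ∨ B (e.symm ⟨_, c.2⟩) = e.symm ⟨_, c.1⟩}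

variable {F B : ℕ → ℕ}

theorem isCorrespondence_neighbourRel
    (h : IsNeighbourPair ((input P e).nat 1 · 0) ((input P e).real 0) P.size t F B) (i : ℕ)
    (hi : i + 1 < t) : IsCorrespondence (neighbourRel P e F B i hi) := by
  refine ⟨Set.eq_univ_of_forall fun u => ?_, Set.eq_univ_of_forall fun v => ?_⟩
  · have hu : (input P e).nat 1 (e.symm ⟨_, u⟩) 0 = i := input_level_symm _ u
    have hF := h.succ _ (e.symm ⟨_, u⟩).2 (by simpa only [hu] using hi)
    obtain ⟨v, hv⟩ := exists_symm_eq (e := e) (i := ⟨i + 1, hi⟩) hF.lt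
      (by have := hF.lev_eq; simpa only [hu] using this)
    exact ⟨(u, v), .inl hv.symm, rfl⟩
  · have hv : (input P e).nat 1 (e.symm ⟨_, v⟩) 0 = i + 1 := input_level_symm _ v
    have hB := h.pred _ (e.symm ⟨_, v⟩).2 (by simp only [hv]; omega)
    obtain ⟨u, hu⟩ := exists_symm_eq (e := e) (i := ⟨i, Nat.lt_of_succ_lt hi⟩) hB.lt
      (by have := hB.lev_eq; simpa only [hv, Nat.add_sub_cancel] using this)
    exact ⟨(u, v), .inr hu.symm, rfl⟩

/-- A nearest neighbour is within every `δ` for which `P` admits a clustering. -/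
theorem isLocal_neighbourRel
    (h : IsNeighbourPair ((input P e).nat 1 · 0) ((input P e).real 0) P.size t F B) {χ δ : ℝ}
    (hP : Admits P χ δ) (i : ℕ) (hi : i + 1 < t) : IsLocal δ (neighbourRel P e F B i hi) := by
  rintro ⟨u, v⟩ huv
  have hu : (input P e).nat 1 (e.symm ⟨_, u⟩) 0 = i := input_level_symm _ u
  have hv : (input P e).nat 1 (e.symm ⟨_, v⟩) 0 = i + 1 := input_level_symm _ v
  obtain huv | huv := huv
  · obtain ⟨w, hw⟩ := hP.exists_succ hi u
    have hF := (h.succ _ (e.symm ⟨_, u⟩).2 (by simpa only [hu] using hi)).dist_le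
      (e.symm ⟨_, w⟩) (e.symm ⟨_, w⟩).2 (by simp only [hu]; exact input_level_symm _ w)
    rw [huv, input_dist_symm, input_dist_symm] at hF
    exact hF.trans hw
  · obtain ⟨w, hw⟩ := hP.exists_pred hi v
    have hB := (h.pred _ (e.symm ⟨_, v⟩).2 (by simp only [hv]; omega)).dist_le
      (e.symm ⟨_, w⟩) (e.symm ⟨_, w⟩).2
      (by simp only [hv, Nat.add_sub_cancel]; exact input_level_symm _ w)
    rw [huv, input_dist_symm, input_dist_symm, dist_comm, dist_comm (v : X)] at hB
    exact hB.trans hw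

theorem fromPathCover_neighbourRel
    (h : IsNeighbourPair ((input P e).nat 1 · 0) ((input P e).real 0) P.size t F B) {s : Memory}
    (hk : outK s = P.size)
    (hs : ∀ q j, s.nat 3 q j = 1 ↔ j < P.size ∧ ∃ m < P.size, F^[m] j = q ∨ B^[m] j = q) :
    FromPathCover P (neighbourRel P e F B) (outLabel P e s) := by
  have hlev : ∀ j < P.size, (input P e).nat 1 j 0 < t := fun j hj => by
    rw [input_level ⟨j, hj⟩]
    exact Fin.is_lt _
  have hj : ∀ j : Fin (outK s), (j : ℕ) < P.size := fun j => hk ▸ j.2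
  have hτ : ∀ (j : Fin (outK s)) (i : Fin t), ∃ u : P.level i, (e.symm ⟨i, u⟩ : ℕ) =
      pathPoint ((input P e).nat 1 · 0) F B j i := fun j i =>
    have := h.pathPoint_spec (hj j) i.2
    exists_symm_eq this.1 this.2
  choose τ hτ using hτ
  have hτ' : ∀ i (u : P.level i) j, τ j i = u ↔
      pathPoint ((input P e).nat 1 · 0) F B j i = e.symm ⟨i, u⟩ := fun i u j => by
    rw [← hτ]
    exact ⟨fun h => by rw [h], symm_inj⟩
  refine ⟨τ, fun j i hi => ?_, fun i u => ⟨⟨e.symm ⟨i, u⟩, by rw [hk]; exact Fin.is_lt _⟩, ?_⟩,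
    fun i u => Set.ext fun j => ?_⟩
  · simp only [neighbourRel, Set.mem_ofPred_eq, hτ]
    exact pathPoint_step _ F B j i
  · rw [hτ']
    have := pathPoint_self ((input P e).nat 1 · 0) F B (e.symm ⟨i, u⟩)
    simpa only [input_level_symm] using this
  · have hv := h.visited_iff P.length_le_size (q := e.symm ⟨i, u⟩) (hj j) (hlev _ (hj j))
      (by simp only [input_level_symm, Fin.is_lt])
    simp only [input_level_symm] at hv
    rw [Set.mem_ofPred_eq, hτ', ← hv]
    exact (hs _ _).trans (and_iff_right (hj j))

/-- Adding half of the maximal error to the subdominant ultrametric gives a pseudo-ultrametric. -/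
theorem isPseudoUltrametric_outDist {s : Memory} {ε : ℝ} (hε : 0 ≤ ε)
    (hs : ∀ x < P.size, ∀ y < P.size, s.real 1 x y = if x = y then 0 else
      subdominant ((input P e).nat 1 · 0) ((input P e).real 0) P.size x y + 1 / 2 * ε) (i : Fin t) :
    IsPseudoUltrametric (outDist P e s i) := by
  have hsymm : ∀ x < P.size, ∀ y < P.size, (input P e).real 0 x y = (input P e).real 0 y x :=
    fun x hx y hy => by
      rw [input_dist ⟨x, hx⟩ ⟨y, hy⟩, input_dist ⟨y, hy⟩ ⟨x, hx⟩, dist_comm]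
  have hnn : ∀ x < P.size, ∀ y < P.size, 0 ≤ (input P e).real 0 x y :=
    fun x hx y hy => by
      rw [input_dist ⟨x, hx⟩ ⟨y, hy⟩]
      exact dist_nonneg
  have hout : ∀ u v, outDist P e s i u v = _ := fun u v =>
    hs (e.symm ⟨i, u⟩) (Fin.is_lt _) (e.symm ⟨i, v⟩) (Fin.is_lt _)
  refine isPseudoUltrametric_of (fun u => by simp [hout]) (fun u v => ?_) fun u v w => ?_
  · rw [hout, hout, subdominant_comm hsymm le_rfl (Fin.is_lt _) (Fin.is_lt _)]
    exact if_congr eq_comm rfl rfl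
  · have h := subdominant_ultra (lev := ((input P e).nat 1 · 0)) (d := (input P e).real 0)
      (p := e.symm ⟨i, u⟩) (q := e.symm ⟨i, w⟩) (r := e.symm ⟨i, v⟩) (Fin.is_lt _)
      (by simp only [input_level_symm]) (by simp only [input_level_symm])
    have h' := subdominant_nonneg (lev := ((input P e).nat 1 · 0)) hnn le_rfl
      (e.symm ⟨i, u⟩).2 (e.symm ⟨i, v⟩).2
    rw [hout, hout, hout]
    grind

/-- The error of the subdominant ultrametric lies in `[0, ε]`, so the shift by `ε / 2` centers it,
and `ε / 2` is at most any admissible `χ`. -/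
theorem linfDist_outDist_le {s : Memory} {ε χ δ : ℝ} (hP : Admits P χ δ) (hχ : 0 ≤ χ)
    (hle : ∀ x < P.size, ∀ y < P.size, (input P e).nat 1 x 0 = (input P e).nat 1 y 0 →
      (input P e).real 0 x y -
        subdominant ((input P e).nat 1 · 0) ((input P e).real 0) P.size x y ≤ ε)
    (hleast : ∀ b, 0 ≤ b → (∀ x < P.size, ∀ y < P.size,
      (input P e).nat 1 x 0 = (input P e).nat 1 y 0 → (input P e).real 0 x y -
        subdominant ((input P e).nat 1 · 0) ((input P e).real 0) P.size x y ≤ b) → ε ≤ b)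
    (hs : ∀ x < P.size, ∀ y < P.size, s.real 1 x y = if x = y then 0 else
      subdominant ((input P e).nat 1 · 0) ((input P e).real 0) P.size x y + 1 / 2 * ε) (i : Fin t) :
    linfDist (fun u v : P.level i => dist (u : X) (v : X)) (outDist P e s i) ≤ χ := by
  have : Nonempty (P.level i) := (P.nonempty i).to_subtype
  have hεχ : ε ≤ 2 * χ := hleast _ (by linarith) fun x hx y hy hxy => hP.error_le hx hy hxy
  refine linfDist_le_iff.2 fun u v => ?_
  have hout : outDist P e s i u v = _ :=
    hs (e.symm ⟨i, u⟩) (Fin.is_lt _) (e.symm ⟨i, v⟩) (Fin.is_lt _)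
  rw [hout]
  split_ifs with huv
  · simpa [symm_inj huv] using hχ
  · have h₁ := hle (e.symm ⟨i, u⟩) (Fin.is_lt _) (e.symm ⟨i, v⟩) (Fin.is_lt _)
      (by rw [input_level_symm, input_level_symm])
    have h₂ := subdominant_le (lev := ((input P e).nat 1 · 0)) (d := (input P e).real 0)
      P.size (e.symm ⟨i, u⟩) (e.symm ⟨i, v⟩)
    rw [input_dist_symm] at h₁ h₂
    rw [abs_le]
    constructor <;> linarith

end Input

end TemporalClustering

open TemporalClustering in
theorem mainTheorem2 :
    ∃ (A : TemporalClustering.Prog) (c : ℕ),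
      ∀ (X : Type*) [MetricSpace X] (t : ℕ), 0 < t →
      ∀ (P : TemporalClustering.TemporalSampling X t)
        (e : Fin P.size ≃ Σ i : Fin t, P.level i),
      ∃ (T : ℕ) (s : TemporalClustering.Memory),
        TemporalClustering.Exec A (TemporalClustering.input P e) T s ∧
        T ≤ c * P.size ^ 3 ∧
        ∃ C : P.Rel,
          (∀ i h, TemporalClustering.IsCorrespondence (C i h)) ∧
          TemporalClustering.FromPathCover P C (TemporalClustering.outLabel P e s) ∧
          ∀ χ δ : ℝ, 0 ≤ χ → 0 ≤ δ → TemporalClustering.Admits P χ δ →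
            TemporalClustering.IsClustering P χ δ (TemporalClustering.outDist P e s)
              (TemporalClustering.outK s) (TemporalClustering.outLabel P e s) ∧
            ∀ i h, TemporalClustering.IsLocal δ (C i h) := by
  obtain ⟨c, hc⟩ := clusteringProgram_spec
  refine ⟨clusteringProgram, c, fun X _ t ht P e => ?_⟩
  obtain ⟨T, s, hex, hT, hk, ⟨ε, hε, hle, hleast, hμ⟩, F, B, hFB, hL⟩ :=
    hc (n := P.size) (t := t) (s₀ := input P e) (ht.trans_le P.length_le_size) (by simp [input])
      (by simp [input])
      (fun l hl => by
        obtain ⟨x, hx⟩ := P.nonempty ⟨l, hl⟩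
        exact ⟨e.symm ⟨⟨l, hl⟩, x, hx⟩, Fin.is_lt _, input_level_symm _ _⟩)
      (fun q hq => by
        rw [input_level ⟨q, hq⟩]
        exact Fin.is_lt _)
      (by simp [input]) (by simp [input]) (by simp [input])
  have hcover := fromPathCover_neighbourRel hFB hk hL
  refine ⟨T, s, hex, hT, neighbourRel P e F B, isCorrespondence_neighbourRel hFB, hcover,
    fun χ δ hχ _ hP => ?_⟩
  have hloc := isLocal_neighbourRel hFB hP
  exact ⟨⟨isPseudoUltrametric_outDist hε hμ, linfDist_outDist_le hP hχ hle hleast hμ, hk.le,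
    hcover.isLabeling, fun i hi => hcover.contiguous (hloc i hi)⟩, hloc⟩
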